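/- Let $a,b>0$, $2\omega_1=-ib$, $2\omega_2=ab$, $\Omega=\omega_2/\omega_1=ia$, and set $$\theta(z|\Omega)=\sum_{n\in\mathbb Z}e^{\pi i n^2\Omega+2\pi i nz},\qquad \theta_{11}(z)=\sum_{n\in\mathbb Z}e^{\pi i\Omega(n+\frac12)^2+2\pi i(n+\frac12)(z+\frac12)},$$ $$F(z)=\log\theta_{11}\Bigl(\frac z{2\omega_1}\Bigr),\qquad F_k(z)=\frac{(-1)^{k-1}}{(k-1)!}F^{(k)}(z)\quad(k\ge1),$$ and define $q_{i,j}$ $(i,j\ge 1)$ by the Taylor expansion at $(0,0)$ $$\frac{\partial^2}{\partial z_1\partial z_2}\log\frac{\theta_{11}\left(\frac{z_2-z_1}{2\omega_1}\right)}{z_2-z_1}=\sum_{i,j\ge1}q_{i,j}z_1^{i-1}z_2^{j-1},\qquad q(t)=\sum_{i,j\ge1}q_{i,j}t_it_j .$$ For $t=(t_1,t_2,\dots)$ and $x=t_1$ let $\tau_0(t)=e^{\frac12q(t)}\theta\bigl(\frac{x}{2\omega_1}+e\,|\,\Omega\bigr)$ with $e\in\mathbb C$. Where the series $q(t)$ does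 not converge, $\tau_0(t)$ denotes the value at $\lambda=1$ of the (single-valued) analytic continuation of $\lambda\mapsto\tau_0(\lambda t_1,\lambda^2t_2,\lambda^3t_3,\dots)$ from a neighbourhood of $\lambda=0$ to a disc of radius $>1$ minus a relatively closed countable set not containing $0$ and $1$. Put $[\mu]=(\mu,\mu^2/2,\mu^3/3,\dots)$, $\eta(t,z)=\sum_{k\ge1}t_kz^k$, $\tilde\partial=(\partial_1,\partial_2/2,\partial_3/3,\dots)$ and let $$X(P,Q)=e^{\eta(t,P)-\eta(t,Q)}e^{-\eta(\tilde\partial,P^{-1})+\eta(\tilde\partial,Q^{-1})},\qquad\text{i.e. } (X(P,Q)f)(t)=e^{\eta(t,P)-\eta(t,Q)}f(t-[P^{-1}]+[Q^{-1}])$$ be the vertex operator, products being understood through $$X(P_1,Q_1)\cdots X(P_n,Q_n)=\prod_{k<l}\frac{(P_k-P_l)(Q_k-Q_l)}{(P_k-Q_l)(Q_k-P_l)}\;:X(P_1,Q_1)\cdots X(P_n,Q_n):$$ with normal ordering $:\ :$ (all shifts to the right). Let $M,N$ be nonnegative integers, $p_1,\dots,p_{N+M}\in\mathbb C$, $q_i=p_{N+i}$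 for $1\le i\le M$, with $\theta_{11}(p_i/2\omega_1)\ne0$ for all $i$ (equivalently $p_i\notin2\omega_1\mathbb Z+2\omega_2\mathbb Z$; in particular $p_i\neq 0$) and $q_i\ne p_j$ for $1\le i\le M$, $1\le j\le N$. Let $(a_{i,j})$ be a complex $M\times N$ matrix, $\Delta(x_1,\dots,x_n)=\prod_{i<j}(x_j-x_i)$, and $$\tau(t)=\Delta(p_1^{-1},\dots,p_N^{-1})\,e^{\sum_{j=1}^N\eta(t,p_j^{-1})}\,e^{\sum_{i,j}a_{i,j}X(q_i^{-1},p_j^{-1})}\,\tau_0\Bigl(t-\sum_{j=1}^N[p_j]\Bigr).$$ Let $B=(b_{i,j})$ be the $(N+M)\times N$ matrix with $b_{i,j}=\delta_{i,j}$ for $i\le N$ and $b_{N+i,j}=a_{i,j}\prod_{m\ne j}\frac{p_j^{-1}-p_m^{-1}}{q_i^{-1}-p_m^{-1}}$. For $I=\{i_1<\dots<i_N\}\subset\{1,\dots,N+M\}$ let $B_I=\det(b_{i_r,s})_{1\le r,s\le N}$ and $$C_I=\prod_{j\in I}\frac{p_j}{\theta_{11}\left(\frac{p_j}{2\omega_1}\right)^N}\prod_{j,k\in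 I,\,j<k}\theta_{11}\Bigl(\frac{p_k-p_j}{2\omega_1}\Bigr).$$ **Proposition.** There are constants $c\ne0$ and $c_1,c_2,\dots\in\mathbb C$, depending only on $a,b,N$, such that for all $M$, $(p_i)$, $(a_{i,j})$, $e$ as above and all $t$ for which $\sum_k|t_k|r^k<\infty$ for every $r>0$ (e.g. all $t$ with finitely many nonzero entries): the series $q(t)$, $\sum_jc_jt_j$ and $\sum_kt_kF_k(p_i)$ converge absolutely, the values $\tau_0(t)$ and $\tau_0(t-\sum_{i\in I}[p_i])$ exist, the first being given by the series expression, and $$\tau(t)=c\,e^{\sum_{j\ge1}c_jt_j+\frac12q(t)}\sum_IB_IC_I\,e^{\sum_{j\in I}\sum_{k\ge1}t_kF_k(p_j)}\,\theta\Bigl(\frac{x-\sum_{j\in I}p_j}{2\omega_1}+e\,\Big|\,\Omega\Bigr).$$ -/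

import Mathlib

open Filter Topology Finset

noncomputable section

namespace EllipticKP

/-! ### Time variables and vertex operators -/

/-- The KP times `t = (t₁, t₂, t₃, …)`. -/
abbrev Times := ℕ+ → ℂ

/-- The times for which `η(t, z) = ∑ tₖ zᵏ` converges for every complex `z`
(in particular all sequences with finitely many nonzero entries). -/
def IsEntireTimes (t : Times) : Prop :=
  ∀ r : ℝ, Summable fun k : ℕ+ => ‖t k‖ * r ^ (k : ℕ)

/-- `[μ] = (μ, μ²/2, μ³/3, …)`. -/
def miwa (μ : ℂ) : Times := fun k => μ ^ (k : ℕ) / (k : ℕ)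

/-- `η(t, z) = ∑ₖ tₖ zᵏ`. -/
def eta (t : Times) (z : ℂ) : ℂ := ∑' k : ℕ+, t k * z ^ (k : ℕ)

/-- The vertex operator `X(P, Q) = e^{η(t,P) - η(t,Q)} e^{-η(∂̃,P⁻¹) + η(∂̃,Q⁻¹)}` with
`∂̃ = (∂₁, ∂₂/2, ∂₃/3, …)`; the second factor is the shift `t ↦ t - [P⁻¹] + [Q⁻¹]`. -/
def vertexOp (P Q : ℂ) (f : Times → ℂ) (t : Times) : ℂ :=
  Complex.exp (eta t P - eta t Q) * f (t - miwa P⁻¹ + miwa Q⁻¹)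

/-- The normal ordered product `: X(P₁,Q₁) ⋯ X(Pₙ,Qₙ) :`, all shifts acting first. -/
def normalOrdered {n : ℕ} (P Q : Fin n → ℂ) (f : Times → ℂ) (t : Times) : ℂ :=
  Complex.exp (∑ k, (eta t (P k) - eta t (Q k))) *
    f (t - ∑ k, miwa (P k)⁻¹ + ∑ k, miwa (Q k)⁻¹)

/-- The scalar `∏_{k<l} (P_k - P_l)(Q_k - Q_l) / ((P_k - Q_l)(Q_k - P_l))`. -/
def vertexCoeff {n : ℕ} (P Q : Fin n → ℂ) : ℂ :=
  ∏ k, ∏ l ∈ Ioi k, ((P k - P l) * (Q k - Q l)) / ((P k - Q l) * (Q k - P l))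

/-- The product `X(P₁,Q₁) ⋯ X(Pₙ,Qₙ)`. For general parameters the iterated operator is a divergent
series; as usual the product is the rational continuation in the parameters of the composition,
i.e. `vertexCoeff` times the normal ordered product. See `vertexProd_one` and `vertexProd_two`
for the agreement with the composition where the latter converges. -/
def vertexProd {n : ℕ} (P Q : Fin n → ℂ) (f : Times → ℂ) (t : Times) : ℂ :=
  vertexCoeff P Q * normalOrdered P Q f t

/-- `exp (∑_{i,j} A_{ij} X(P_i, Q_j))`, i.e. `∑ₙ (1/n!) (∑_{i,j} A_{ij} X(P_i,Q_j))ⁿ` with the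
`n`-th power multiplied out. -/
def expVertex {M N : ℕ} (A : Matrix (Fin M) (Fin N) ℂ) (P : Fin M → ℂ) (Q : Fin N → ℂ)
    (f : Times → ℂ) (t : Times) : ℂ :=
  ∑' n : ℕ, (1 / (n.factorial : ℂ)) * ∑ w : Fin n → Fin M × Fin N,
    (∏ k, A (w k).1 (w k).2) *
      vertexProd (fun k => P (w k).1) (fun k => Q (w k).2) f t

theorem vertexProd_one (P Q : ℂ) (f : Times → ℂ) (t : Times) :
    vertexProd (n := 1) ![P] ![Q] f t = vertexOp P Q f t := by
  simp [vertexProd, vertexCoeff, normalOrdered, vertexOp]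

theorem hasSum_eta_miwa {x z : ℂ} (h : ‖x * z‖ < 1) :
    HasSum (fun k : ℕ+ => miwa x k * z ^ (k : ℕ)) (-Complex.log (1 - x * z)) := by
  have h1 := Complex.hasSum_taylorSeries_neg_log h
  have h2 : HasSum (fun k : ℕ+ => (x * z) ^ (k : ℕ) / ((k : ℕ) : ℂ))
      (-Complex.log (1 - x * z)) := by
    refine (PNat.coe_injective.hasSum_iff ?_).2 h1
    intro n hn
    have : n = 0 := by
      by_contra h0
      exact hn ⟨⟨n, Nat.pos_of_ne_zero h0⟩, rfl⟩
    simp [this]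
  refine h2.congr_fun ?_ |> fun h => h
  intro k
  simp only [miwa, mul_pow]
  ring

theorem IsEntireTimes.summable_eta {t : Times} (ht : IsEntireTimes t) (z : ℂ) :
    Summable fun k : ℕ+ => t k * z ^ (k : ℕ) := by
  refine Summable.of_norm ?_
  simpa [norm_mul, norm_pow] using ht ‖z‖

theorem exp_eta_shift {t : Times} (ht : IsEntireTimes t) {P Q z : ℂ}
    (hP : ‖z‖ < ‖P‖) (hQ : ‖z‖ < ‖Q‖) :
    Complex.exp (eta (t - miwa P⁻¹ + miwa Q⁻¹) z) =
      Complex.exp (eta t z) * ((1 - P⁻¹ * z) / (1 - Q⁻¹ * z)) := by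
  have key : ∀ R : ℂ, ‖z‖ < ‖R‖ → ‖R⁻¹ * z‖ < 1 := by
    intro R hR
    have hR0 : 0 < ‖R‖ := lt_of_le_of_lt (norm_nonneg z) hR
    rw [norm_mul, norm_inv, inv_mul_lt_iff₀ hR0]
    simpa using hR
  have ne : ∀ R : ℂ, ‖z‖ < ‖R‖ → 1 - R⁻¹ * z ≠ 0 := by
    intro R hR h0
    have h1 := key R hR
    have h2 : R⁻¹ * z = 1 := (sub_eq_zero.1 h0).symm
    rw [h2] at h1
    simp at h1
  have h := (((ht.summable_eta z).hasSum.sub (hasSum_eta_miwa (key P hP))).add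
    (hasSum_eta_miwa (key Q hQ))).tsum_eq
  have h' : eta (t - miwa P⁻¹ + miwa Q⁻¹) z =
      eta t z - -Complex.log (1 - P⁻¹ * z) + -Complex.log (1 - Q⁻¹ * z) := by
    refine Eq.trans ?_ h
    unfold eta
    refine tsum_congr fun k => ?_
    simp only [Pi.add_apply, Pi.sub_apply]
    ring
  rw [h', sub_neg_eq_add, Complex.exp_add, Complex.exp_add, Complex.exp_neg,
    Complex.exp_log (ne P hP), Complex.exp_log (ne Q hQ)]
  ring

/-- Where the composition of two vertex operators converges, it is the product defined above. -/
theorem vertexProd_two {t : Times} (ht : IsEntireTimes t) {P₁ Q₁ P₂ Q₂ : ℂ}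
    (h₁ : ‖P₂‖ < ‖P₁‖) (h₂ : ‖Q₂‖ < ‖P₁‖) (h₃ : ‖P₂‖ < ‖Q₁‖) (h₄ : ‖Q₂‖ < ‖Q₁‖)
    (f : Times → ℂ) :
    vertexOp P₁ Q₁ (vertexOp P₂ Q₂ f) t = vertexProd ![P₁, P₂] ![Q₁, Q₂] f t := by
  have e1 := exp_eta_shift ht h₁ h₃
  have e2 := exp_eta_shift ht h₂ h₄
  have hP : P₁ ≠ 0 := norm_pos_iff.1 (lt_of_le_of_lt (norm_nonneg _) h₁)
  have hQ : Q₁ ≠ 0 := norm_pos_iff.1 (lt_of_le_of_lt (norm_nonneg _) h₃)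
  have a1 : P₁ - Q₂ ≠ 0 := fun h => by rw [sub_eq_zero.1 h] at h₂; exact lt_irrefl _ h₂
  have a2 : Q₁ - P₂ ≠ 0 := fun h => by rw [sub_eq_zero.1 h] at h₃; exact lt_irrefl _ h₃
  have hs : t - miwa P₁⁻¹ + miwa Q₁⁻¹ - miwa P₂⁻¹ + miwa Q₂⁻¹ =
      t - (miwa P₁⁻¹ + miwa P₂⁻¹) + (miwa Q₁⁻¹ + miwa Q₂⁻¹) := by abel
  have hI : (Ioi (0 : Fin 2)) = {1} := by decide
  have hI' : (Ioi (1 : Fin 2)) = ∅ := by decide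
  have hc : (1 - P₁⁻¹ * P₂) / (1 - Q₁⁻¹ * P₂) / ((1 - P₁⁻¹ * Q₂) / (1 - Q₁⁻¹ * Q₂)) =
      ((P₁ - P₂) * (Q₁ - Q₂)) / ((P₁ - Q₂) * (Q₁ - P₂)) := by
    have b1 : 1 - P₁⁻¹ * P₂ = (P₁ - P₂) / P₁ := by field_simp
    have b2 : 1 - Q₁⁻¹ * P₂ = (Q₁ - P₂) / Q₁ := by field_simp
    have b3 : 1 - P₁⁻¹ * Q₂ = (P₁ - Q₂) / P₁ := by field_simp
    have b4 : 1 - Q₁⁻¹ * Q₂ = (Q₁ - Q₂) / Q₁ := by field_simp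
    rw [b1, b2, b3, b4]
    field_simp
  simp only [vertexOp, vertexProd, vertexCoeff, normalOrdered, Fin.prod_univ_two,
    Fin.sum_univ_two, hI, hI', Finset.prod_singleton, Finset.prod_empty, mul_one,
    Matrix.cons_val_zero, Matrix.cons_val_one, hs]
  rw [Complex.exp_sub (eta (t - miwa P₁⁻¹ + miwa Q₁⁻¹) P₂), e1, e2, ← hc, Complex.exp_add,
    Complex.exp_sub (eta t P₂)]
  have := Complex.exp_ne_zero (eta t Q₂)
  field_simp

/-! ### Genus one data: `2ω₁ = -ib`, `2ω₂ = ab`, `Ω = ω₂/ω₁ = ia` -/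

/-- `2ω₁ = -ib`. -/
def twoω₁ (b : ℝ) : ℂ := -(Complex.I * b)

/-- `2ω₂ = ab`. -/
def twoω₂ (a b : ℝ) : ℂ := (a : ℂ) * b

/-- `Ω = ω₂ / ω₁`. -/
def modulus (a b : ℝ) : ℂ := twoω₂ a b / twoω₁ b

theorem modulus_eq (a : ℝ) {b : ℝ} (hb : 0 < b) : modulus a b = Complex.I * a := by
  have hb' : (b : ℂ) ≠ 0 := by exact_mod_cast hb.ne'
  have : -(Complex.I * (b : ℂ)) ≠ 0 := neg_ne_zero.2 (mul_ne_zero Complex.I_ne_zero hb')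
  rw [modulus, twoω₁, twoω₂, div_eq_iff this]
  linear_combination ((a : ℂ) * b) * Complex.I_mul_I

/-- Riemann's theta function `θ(z|Ω) = ∑_{n ∈ ℤ} exp(πi n²Ω + 2πi n z)` in genus one. -/
def theta (a b : ℝ) (z : ℂ) : ℂ := jacobiTheta₂ z (modulus a b)

/-- `θ₁₁(z|Ω) = ∑_{n ∈ ℤ} exp(πi Ω (n+1/2)² + 2πi (n+1/2)(z+1/2))`. -/
def theta11 (a b : ℝ) (z : ℂ) : ℂ :=
  ∑' n : ℤ, Complex.exp (Real.pi * Complex.I * modulus a b * ((n : ℂ) + 1 / 2) ^ 2 +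
    2 * Real.pi * Complex.I * ((n : ℂ) + 1 / 2) * (z + 1 / 2))

/-- `F'(z)` for `F(z) = log θ₁₁(z / 2ω₁)`, independent of the branch of the logarithm. -/
def dlogTheta (a b : ℝ) (z : ℂ) : ℂ := logDeriv (fun w => theta11 a b (w / twoω₁ b)) z

/-- `F_j(z) = (-1)^{j-1} / (j-1)! · F^{(j)}(z)` for `j ≥ 1`. -/
def Fcoef (a b : ℝ) (j : ℕ+) (z : ℂ) : ℂ :=
  (-1) ^ ((j : ℕ) - 1) / (((j : ℕ) - 1).factorial : ℂ) *
    iteratedDeriv ((j : ℕ) - 1) (dlogTheta a b) z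

/-- `u ↦ θ₁₁(u / 2ω₁) / u`, with its removable singularity at `u = 0` filled in
(note `θ₁₁(0) = 0`). -/
def thetaQuot (a b : ℝ) : ℂ → ℂ := dslope (fun u => theta11 a b (u / twoω₁ b)) 0

/-- `∂² / ∂z₁∂z₂ log (θ₁₁((z₂ - z₁) / 2ω₁) / (z₂ - z₁))`; the inner `z₂`-derivative of the
logarithm is a logarithmic derivative, so no branch has to be chosen. -/
def bidiff (a b : ℝ) (z₁ z₂ : ℂ) : ℂ :=
  deriv (fun w₁ => logDeriv (fun w₂ => thetaQuot a b (w₂ - w₁)) z₂) z₁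

/-- The coefficient `q_{ij}` of `z₁^{i-1} z₂^{j-1}` in the Taylor expansion of `bidiff`
at `(0, 0)`. -/
def qcoef (a b : ℝ) (i j : ℕ+) : ℂ :=
  iteratedDeriv ((i : ℕ) - 1)
    (fun z₁ => iteratedDeriv ((j : ℕ) - 1) (fun z₂ => bidiff a b z₁ z₂) 0) 0 /
    ((((i : ℕ) - 1).factorial : ℂ) * (((j : ℕ) - 1).factorial : ℂ))

/-- The series `q(t) = ∑_{i,j} q_{ij} tᵢ tⱼ` converges absolutely. -/
def QSummable (a b : ℝ) (t : Times) : Prop :=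
  Summable fun ij : ℕ+ × ℕ+ => qcoef a b ij.1 ij.2 * t ij.1 * t ij.2

/-- `q(t) = ∑_{i,j} q_{ij} tᵢ tⱼ`. -/
def qform (a b : ℝ) (t : Times) : ℂ :=
  ∑' ij : ℕ+ × ℕ+, qcoef a b ij.1 ij.2 * t ij.1 * t ij.2

/-- The series expression `e^{q(t)/2} θ(t₁ / 2ω₁ + e | Ω)` of the seed `τ₀`. -/
def tauSeries (a b : ℝ) (e : ℂ) (t : Times) : ℂ :=
  Complex.exp (qform a b t / 2) * theta a b (t 1 / twoω₁ b + e)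

/-- The weighted dilation `λ · t = (λ t₁, λ² t₂, λ³ t₃, …)`. It sends `[μ]` to `[λ μ]`. -/
def dilate (l : ℂ) (t : Times) : Times := fun k => l ^ (k : ℕ) * t k

/-- `v` is the value at `t` of the seed `τ₀`: the series `e^{q/2} θ` converges at `λ · t`
for small `λ`, and its analytic continuation in `λ` takes the value `v` at `λ = 1`.
The continuation is required on a disc of radius `> 1` with a relatively closed countable set
of singular points (not containing `0` and `1`) removed. -/
def IsTauValue (a b : ℝ) (e : ℂ) (t : Times) (v : ℂ) : Prop :=
  ∃ (r : ℝ) (S : Set ℂ) (φ : ℂ → ℂ), 1 < r ∧ S.Countable ∧ (0 : ℂ) ∉ S ∧ (1 : ℂ) ∉ S ∧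
    IsOpen (Metric.ball (0 : ℂ) r \ S) ∧ DifferentiableOn ℂ φ (Metric.ball (0 : ℂ) r \ S) ∧
    (∀ᶠ l in 𝓝 (0 : ℂ), QSummable a b (dilate l t) ∧ φ l = tauSeries a b e (dilate l t)) ∧
    φ 1 = v

/-- A countable set can be avoided on a connected set joining `0` and `1` in the unit disc. -/
theorem exists_connected_avoiding {S : Set ℂ} (hS : S.Countable) (h0 : (0 : ℂ) ∉ S)
    (h1 : (1 : ℂ) ∉ S) {r : ℝ} (hr : 1 < r) :
    ∃ U : Set ℂ, IsPreconnected U ∧ (0 : ℂ) ∈ U ∧ (1 : ℂ) ∈ U ∧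
      U ⊆ Metric.ball (0 : ℂ) r \ S := by
  set B : Set ℝ := (fun s : ℂ => s.im / (2 * s.re)) '' S ∪
    (fun s : ℂ => s.im / (2 * (1 - s.re))) '' S with hB
  have hBc : B.Countable := (hS.image _).union (hS.image _)
  obtain ⟨y, hy, hyB⟩ : ∃ y ∈ Set.Ioo (0 : ℝ) (1 / 2), y ∈ Bᶜ := by
    obtain ⟨y, hy, hyB⟩ := (hBc.dense_compl ℝ).inter_open_nonempty _ (isOpen_Ioo (a := (0 : ℝ))
      (b := 1 / 2)) ⟨1 / 4, by norm_num, by norm_num⟩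
    exact ⟨y, hy, hyB⟩
  set c : ℂ := ⟨1 / 2, y⟩ with hc
  have hcn : ‖c‖ ≤ 1 := by
    refine (Complex.norm_le_abs_re_add_abs_im c).trans ?_
    have e1 : |c.re| = 1 / 2 := by simp [hc]
    have e2 : |c.im| = y := by simp [hc, abs_of_pos hy.1]
    rw [e1, e2]
    linarith [hy.2]
  have conv : Convex ℝ (Metric.ball (0 : ℂ) r) := convex_ball _ _
  have m0 : (0 : ℂ) ∈ Metric.ball (0 : ℂ) r := by
    simpa using lt_trans zero_lt_one hr
  have m1 : (1 : ℂ) ∈ Metric.ball (0 : ℂ) r := by simpa using hr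
  have mc : c ∈ Metric.ball (0 : ℂ) r := by simpa using lt_of_le_of_lt hcn hr
  refine ⟨segment ℝ 0 c ∪ segment ℝ 1 c, ?_, Or.inl (left_mem_segment ℝ _ _),
    Or.inr (left_mem_segment ℝ _ _), ?_⟩
  · exact (convex_segment _ _).isPreconnected.union c (right_mem_segment ℝ _ _)
      (right_mem_segment ℝ _ _) (convex_segment _ _).isPreconnected
  · rintro s (hs | hs)
    · refine ⟨conv.segment_subset m0 mc hs, fun hsS => ?_⟩
      obtain ⟨u, v, hu, hv, huv, rfl⟩ := hs
      rcases hv.eq_or_lt with rfl | hv'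
      · simp at hsS
        exact h0 hsS
      · refine hyB (Or.inl ⟨_, hsS, ?_⟩)
        simp [hc]
        field_simp
    · refine ⟨conv.segment_subset m1 mc hs, fun hsS => ?_⟩
      obtain ⟨u, v, hu, hv, huv, rfl⟩ := hs
      rcases hv.eq_or_lt with rfl | hv'
      · have : u = 1 := by linarith
        subst this
        simp at hsS
        exact h1 hsS
      · refine hyB (Or.inr ⟨_, hsS, ?_⟩)
        have hu' : u = 1 - v := by linarith
        subst hu'
        have e1 : (((1 : ℝ) - v) • (1 : ℂ) + v • c).im = v * y := by simp [hc]
        have e2 : (((1 : ℝ) - v) • (1 : ℂ) + v • c).re = 1 - v / 2 := by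
          simp [hc]
          ring
        have e3 : 2 * (1 - (1 - v / 2)) = v := by ring
        simp only [e1, e2, e3]
        field_simp

/-- The value of the seed is unique. -/
theorem IsTauValue.unique {a b : ℝ} {e : ℂ} {t : Times} {v w : ℂ}
    (hv : IsTauValue a b e t v) (hw : IsTauValue a b e t w) : v = w := by
  obtain ⟨r, S, φ, hr, hS, h0, h1, ho, hφ, hφt, rfl⟩ := hv
  obtain ⟨r', S', ψ, hr', hS', h0', h1', ho', hψ, hψt, rfl⟩ := hw
  obtain ⟨U, hU, hU0, hU1, hUs⟩ := exists_connected_avoiding (hS.union hS')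
    (by simp [h0, h0']) (by simp [h1, h1']) (lt_min hr hr')
  have s1 : U ⊆ Metric.ball (0 : ℂ) r \ S := fun z hz =>
    ⟨Metric.ball_subset_ball (min_le_left _ _) (hUs hz).1, fun h => (hUs hz).2 (Or.inl h)⟩
  have s2 : U ⊆ Metric.ball (0 : ℂ) r' \ S' := fun z hz =>
    ⟨Metric.ball_subset_ball (min_le_right _ _) (hUs hz).1, fun h => (hUs hz).2 (Or.inr h)⟩
  refine AnalyticOnNhd.eqOn_of_preconnected_of_eventuallyEq
    ((hφ.analyticOnNhd ho).mono s1) ((hψ.analyticOnNhd ho').mono s2) hU hU0 ?_ hU1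
  filter_upwards [hφt, hψt] with l hl hl'
  rw [hl.2, hl'.2]

/-- Where the series converges (on a dilation by some `r > 1`), the value is that of the series. -/
theorem isTauValue_tauSeries {a b : ℝ} (ha : 0 < a) (hb : 0 < b) (e : ℂ) {t : Times} {r : ℝ}
    (hr : 1 < r) (ht : QSummable a b (dilate r t)) :
    IsTauValue a b e t (tauSeries a b e t) := by
  set u : ℕ+ × ℕ+ → ℝ := fun ij =>
    ‖qcoef a b ij.1 ij.2 * dilate r t ij.1 * dilate r t ij.2‖ with hu
  have hus : Summable u := ht.norm
  have hbd : ∀ (ij : ℕ+ × ℕ+) (l : ℂ), l ∈ Metric.ball (0 : ℂ) r →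
      ‖qcoef a b ij.1 ij.2 * dilate l t ij.1 * dilate l t ij.2‖ ≤ u ij := by
    intro ij l hl
    have hl' : ‖l‖ ≤ ‖(r : ℂ)‖ := by
      rw [Complex.norm_real, Real.norm_of_nonneg (by linarith)]
      simpa using (mem_ball_zero_iff.1 hl).le
    simp only [hu, dilate, norm_mul, norm_pow]
    gcongr
  have hsum : ∀ l ∈ Metric.ball (0 : ℂ) r, QSummable a b (dilate l t) := fun l hl =>
    Summable.of_norm_bounded hus fun ij => hbd ij l hl
  have hd : DifferentiableOn ℂ (fun l => qform a b (dilate l t)) (Metric.ball (0 : ℂ) r) := by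
    refine Complex.differentiableOn_tsum_of_summable_norm hus (fun ij => ?_) Metric.isOpen_ball hbd
    simp only [dilate]
    fun_prop
  have hm : 0 < (modulus a b).im := by simp [modulus_eq a hb, ha]
  have hθ : Differentiable ℂ (theta a b) := fun z => differentiableAt_jacobiTheta₂_fst z hm
  have hone : dilate 1 t = t := by
    funext k
    simp [dilate]
  refine ⟨r, ∅, fun l => tauSeries a b e (dilate l t), hr, Set.countable_empty, by simp, by simp,
    by simp, ?_, ?_, by simp only [hone]⟩
  · rw [Set.sdiff_empty]
    unfold tauSeries
    refine DifferentiableOn.mul (by fun_prop) ?_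
    refine (hθ.comp (f := fun l => dilate l t 1 / twoω₁ b + e) ?_).differentiableOn
    simp only [dilate]
    fun_prop
  · filter_upwards [Metric.ball_mem_nhds (0 : ℂ) (zero_lt_one.trans hr)] with l hl
    exact ⟨hsum l hl, rfl⟩

open Classical in
/-- The seed `τ₀(t) = e^{q(t)/2} θ(t₁ / 2ω₁ + e | Ω)`, continued analytically as in `IsTauValue`
(and `0` where there is no continuation). -/
def tau0 (a b : ℝ) (e : ℂ) (t : Times) : ℂ :=
  if h : ∃ v, IsTauValue a b e t v then h.choose else 0

theorem IsTauValue.tau0_eq {a b : ℝ} {e : ℂ} {t : Times} {v : ℂ}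
    (hv : IsTauValue a b e t v) : tau0 a b e t = v := by
  have h : ∃ v, IsTauValue a b e t v := ⟨v, hv⟩
  rw [tau0, dif_pos h]
  exact h.choose_spec.unique hv

/-! ### The dressed tau function -/

/-- `Δ(x₁, …, xₙ) = ∏_{i<j} (x_j - x_i)`. -/
def vdm {n : ℕ} (x : Fin n → ℂ) : ℂ := ∏ i, ∏ j ∈ Ioi i, (x j - x i)

/-- `p₁, …, p_N` among `p₁, …, p_{N+M}`. -/
def pPart {N M : ℕ} (p : Fin (N + M) → ℂ) (j : Fin N) : ℂ := p (Fin.castAdd M j)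

/-- `q_i = p_{N+i}`. -/
def qPart {N M : ℕ} (p : Fin (N + M) → ℂ) (i : Fin M) : ℂ := p (Fin.natAdd N i)

/-- `τ(t) = Δ(p₁⁻¹,…,p_N⁻¹) e^{∑ⱼ η(t,pⱼ⁻¹)} G τ₀(t - ∑ⱼ [pⱼ])` with
`G = exp(∑_{i,j} a_{ij} X(q_i⁻¹, p_j⁻¹))`, where `q_i = p_{N+i}`. -/
def tauVO (a b : ℝ) (e : ℂ) {N M : ℕ} (p : Fin (N + M) → ℂ) (A : Matrix (Fin M) (Fin N) ℂ)
    (t : Times) : ℂ :=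
  vdm (fun j => (pPart p j)⁻¹) * Complex.exp (∑ j, eta t (pPart p j)⁻¹) *
    expVertex A (fun i => (qPart p i)⁻¹) (fun j => (pPart p j)⁻¹)
      (fun s => tau0 a b e (s - ∑ j, miwa (pPart p j))) t

/-- The `(N+M) × N` matrix with top block the identity and
`b_{N+i,j} = a_{ij} ∏_{m ≠ j} (p_j⁻¹ - p_m⁻¹) / (q_i⁻¹ - p_m⁻¹)`. -/
def Bmat {N M : ℕ} (p : Fin (N + M) → ℂ) (A : Matrix (Fin M) (Fin N) ℂ) :
    Matrix (Fin (N + M)) (Fin N) ℂ :=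
  Matrix.of fun r j => Fin.addCases (motive := fun _ => ℂ)
    (fun i => if i = j then 1 else 0)
    (fun i => A i j * ∏ m ∈ univ.erase j,
      ((pPart p j)⁻¹ - (pPart p m)⁻¹) / ((qPart p i)⁻¹ - (pPart p m)⁻¹)) r

/-- The index sets `I = (i₁ < ⋯ < i_N)` in `{1, …, N+M}`. -/
def indexSets (N M : ℕ) : Finset (Fin N → Fin (N + M)) :=
  univ.filter fun I => ∀ r s, r < s → I r < I s

/-- The minor `B_I = det (b_{i_r, s})`. -/
def minorB {N M : ℕ} (p : Fin (N + M) → ℂ) (A : Matrix (Fin M) (Fin N) ℂ)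
    (I : Fin N → Fin (N + M)) : ℂ :=
  ((Bmat p A).submatrix I id).det

/-- `C_I = ∏_{j ∈ I} p_j / θ₁₁(p_j/2ω₁)^N · ∏_{j<k in I} θ₁₁((p_k - p_j)/2ω₁)`. -/
def Ccoef (a b : ℝ) {N M : ℕ} (p : Fin (N + M) → ℂ) (I : Fin N → Fin (N + M)) : ℂ :=
  (∏ r, p (I r) / theta11 a b (p (I r) / twoω₁ b) ^ N) *
    ∏ r, ∏ s ∈ Ioi r, theta11 a b ((p (I s) - p (I r)) / twoω₁ b)

end EllipticKP

end

/-!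
The proof separates the two ingredients of `τ`.

*Dressing.* For an arbitrary seed `F`, the operator `exp (∑ aᵢⱼ X(qᵢ⁻¹, pⱼ⁻¹))` expands over the
partial injections from the `p_j` to the `q_i`: each `X(q⁻¹, p⁻¹)` replaces the shift `[p]` by
`[q]`, and a repeated node is killed by a Vandermonde factor. By a Cauchy–Binet expansion the
result is `∑_I B_I` times the Vandermonde product, the exponential and the shifted seed attached
to the nodes `(p_i)_{i ∈ I}`.

*The seed.* Put `E(u) = θ₁₁(u / 2ω₁) / u` and `ζ = (log E)'`. The coefficients of `q` are the
Taylor coefficients of the second kind kernel `-ζ'(z₂ - z₁)`, and summing this series at Miwa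
shifts integrates the kernel twice: `exp (q / 2)` at `t - ∑ᵣ [xᵣ]` acquires the prime form factors
`E(xₛ - xᵣ) E(0) / (E(xᵣ) E(xₛ))` and the exponential of the series of `ζ` at the `xᵣ` and at `0`.
The expansion is valid for small `xᵣ` only, but `E` has countably many zeros, so the closed form is
the continuation along `λ ↦ (λ t₁, λ² t₂, …)`. Since `F' = ζ + 1 / u`, the Vandermonde
product turns the prime form factors into `C_I` and the exponential factors into those of `F_k`;
the series of `ζ` at `0` gives the constants `c_k`.
-/

namespace EllipticKP

/-! ### Vandermonde products -/

theorem vdm_eq_det {n : ℕ} (x : Fin n → ℂ) : vdm x = (Matrix.vandermonde x).det := by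
  rw [vdm, Matrix.det_vandermonde]

theorem vdm_comp_perm {n : ℕ} (x : Fin n → ℂ) (σ : Equiv.Perm (Fin n)) :
    vdm (x ∘ σ) = (σ.sign : ℤ) * vdm x := by
  rw [vdm_eq_det, vdm_eq_det, ← Matrix.det_permute]
  rfl

theorem vdm_eq_zero_of_not_injective {n : ℕ} {x : Fin n → ℂ} (hx : ¬ x.Injective) :
    vdm x = 0 := by
  rwa [vdm_eq_det, ← not_ne_iff, Matrix.det_vandermonde_ne_zero_iff]

theorem vdm_cons {n : ℕ} (a : ℂ) (x : Fin n → ℂ) :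
    vdm (Fin.cons a x) = (∏ i, (x i - a)) * vdm x := by
  simp only [vdm, Fin.prod_univ_succ (n := n), Fin.prod_Ioi_zero, Fin.prod_Ioi_succ,
    Fin.cons_zero, Fin.cons_succ]

theorem vdm_insertNth {n : ℕ} (j : Fin (n + 1)) (a : ℂ) (x : Fin n → ℂ) :
    vdm (j.insertNth a x) = (-1) ^ (j : ℕ) * ((∏ i, (x i - a)) * vdm x) := by
  rw [← vdm_cons, ← Fin.cons_comp_cycleRange, vdm_comp_perm,
    Fin.sign_cycleRange]
  push_cast
  rfl

theorem vdm_update_mul_prod {n : ℕ} (x : Fin n → ℂ) (j : Fin n) (y : ℂ) :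
    vdm (Function.update x j y) * ∏ m ∈ univ.erase j, (x j - x m) =
      vdm x * ∏ m ∈ univ.erase j, (y - x m) := by
  obtain _ | n := n
  · exact j.elim0
  have prod_erase (a : ℂ) : ∏ m ∈ univ.erase j, (a - x m) =
      (-1) ^ n * ∏ i, (j.removeNth x i - a) := by
    rw [← compl_singleton, ← Fin.image_succAbove_univ,
      prod_image Fin.succAbove_right_injective.injOn, ← Fin.prod_const, ← prod_mul_distrib]
    exact prod_congr rfl fun i _ => by simp [Fin.removeNth]
  rw [← Fin.insertNth_removeNth, vdm_insertNth, prod_erase, prod_erase]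
  conv_rhs => rw [← Fin.insertNth_self_removeNth j x, vdm_insertNth, Fin.removeNth_insertNth]
  ring

/-! ### A Cauchy–Binet expansion -/

open Classical in
theorem sum_injective_eq_sum_strictMono_sum_perm {ι A : Type*} [Fintype ι] [LinearOrder ι]
    [AddCommMonoid A] {n : ℕ} (F : (Fin n → ι) → A) :
    ∑ f with Function.Injective f, F f =
      ∑ I : Fin n → ι with StrictMono I, ∑ σ : Equiv.Perm (Fin n), F (I ∘ σ) := by
  rw [← sum_product']
  symm
  refine sum_bij (fun x _ => x.1 ∘ x.2) ?_ ?_ ?_ fun _ _ => rfl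
  · simp only [mem_product, mem_filter_univ, and_imp]
    exact fun x hx _ => hx.injective.comp x.2.injective
  · simp only [mem_product, mem_filter_univ, and_imp]
    rintro ⟨I, σ⟩ hI - ⟨J, τ⟩ hJ - h
    obtain rfl : I = J := (hI.range_inj hJ).1 <| by
      rw [← σ.surjective.range_comp I, ← τ.surjective.range_comp J]
      exact congrArg Set.range h
    exact congrArg _ (Equiv.ext fun s => hI.injective (congrFun h s))
  · simp only [mem_filter_univ, mem_product, mem_univ, and_true]
    exact fun f hf => ⟨(f ∘ Tuple.sort f, (Tuple.sort f)⁻¹),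
      (Tuple.monotone_sort f).strictMono_of_injective (hf.comp (Tuple.sort f).injective),
      funext fun s => by simp⟩

open Classical in
theorem sum_det_submatrix_mul_alternating {ι R : Type*} [Fintype ι] [LinearOrder ι] [CommRing R]
    {n : ℕ} (B : Matrix ι (Fin n) R) (Φ : (Fin n → ι) → R)
    (hperm : ∀ f (σ : Equiv.Perm (Fin n)), Φ (f ∘ σ) = (σ.sign : ℤ) * Φ f)
    (hzero : ∀ f, ¬ Function.Injective f → Φ f = 0) :
    ∑ I with StrictMono I, (B.submatrix I id).det * Φ I = ∑ f, (∏ s, B (f s) s) * Φ f := by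
  calc ∑ I with StrictMono I, (B.submatrix I id).det * Φ I
      = ∑ I with StrictMono I, ∑ σ : Equiv.Perm (Fin n),
          (∏ s, B ((I ∘ σ) s) s) * Φ (I ∘ σ) := by
        refine sum_congr rfl fun I _ => ?_
        rw [Matrix.det_apply', sum_mul]
        refine sum_congr rfl fun σ _ => ?_
        rw [hperm, mul_assoc, mul_left_comm]
        rfl
    _ = ∑ f with Function.Injective f, (∏ s, B (f s) s) * Φ f :=
        (sum_injective_eq_sum_strictMono_sum_perm fun f => (∏ s, B (f s) s) * Φ f).symm
    _ = ∑ f, (∏ s, B (f s) s) * Φ f :=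
        sum_filter_of_ne fun f _ h => not_not.1 fun hf => h (by rw [hzero f hf, mul_zero])

/-! ### Words and partial maps -/

/-- The partial map `β ⇀ α` sending the second component of each letter of the word `w` to the
first one. It collects the substitutions prescribed by `w`, whose second components are meant to
be distinct. -/
noncomputable def partialMapOf {α β : Type*} {n : ℕ} (w : Fin n → α × β) : β → Option α :=
  Function.extend (fun k => (w k).2) (fun k => some (w k).1) fun _ => none

theorem partialMapOf_apply {α β : Type*} {n : ℕ} {w : Fin n → α × β}
    (hw : Function.Injective fun k => (w k).2) (k : Fin n) :
    partialMapOf w (w k).2 = some (w k).1 :=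
  hw.extend_apply _ _ k

theorem exists_eq_of_isSome_partialMapOf {α β : Type*} {n : ℕ} {w : Fin n → α × β} {s : β}
    (hs : (partialMapOf w s).isSome) : ∃ k, (w k).2 = s := by
  by_contra h
  simp [partialMapOf, Function.extend_apply' _ _ s h] at hs

theorem partialMapOf_symm_eq {α β : Type*} {n : ℕ} (g : β → Option α)
    (e : Fin n ≃ {s // (g s).isSome}) :
    partialMapOf (fun k => ((g (e k)).get (e k).2, (e k : β))) = g := by
  have he : Function.Injective fun k => (e k : β) := Subtype.val_injective.comp e.injective
  funext s
  by_cases hs : (g s).isSome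
  · have := partialMapOf_apply (w := fun k => ((g (e k)).get (e k).2, (e k : β))) he
      (e.symm ⟨s, hs⟩)
    simpa using this
  · rw [Option.not_isSome_iff_eq_none.1 hs, partialMapOf, Function.extend_apply']
    rintro ⟨k, rfl⟩
    exact hs (e k).2

/-- An injective word spelling `g` is an enumeration of the domain of `g`. -/
noncomputable def wordEquiv {α β : Type*} (n : ℕ) (g : β → Option α) :
    {w : Fin n → α × β // Function.Injective (fun k => (w k).2) ∧ partialMapOf w = g} ≃
      (Fin n ≃ {s // (g s).isSome}) where
  toFun w := Equiv.ofBijective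
    (fun k => ⟨(w.1 k).2, by simp [congrFun w.2.2.symm, partialMapOf_apply w.2.1]⟩)
    ⟨fun _ _ h => w.2.1 (congrArg Subtype.val h), fun s => by
      obtain ⟨k, hk⟩ := exists_eq_of_isSome_partialMapOf (congrFun w.2.2 s ▸ s.2)
      exact ⟨k, Subtype.ext hk⟩⟩
  invFun e := ⟨fun k => ((g (e k)).get (e k).2, e k),
    Subtype.val_injective.comp e.injective, partialMapOf_symm_eq g e⟩
  left_inv := by
    rintro ⟨w, hw, rfl⟩
    exact Subtype.ext <| funext fun k =>
      Prod.ext (Option.get_of_eq_some _ (partialMapOf_apply hw k)) rfl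
  right_inv e := by
    ext k
    rfl

open Classical in
theorem card_words_eq {α β : Type*} [Fintype α] [Fintype β] [DecidableEq β] (n : ℕ)
    (g : β → Option α) :
    #{w : Fin n → α × β | Function.Injective (fun k => (w k).2) ∧ partialMapOf w = g} =
      if n = Fintype.card {s // (g s).isSome} then n.factorial else 0 := by
  rw [← Fintype.card_subtype, Fintype.card_congr (wordEquiv n g)]
  split_ifs with h
  · rw [Fintype.card_equiv (Fintype.equivOfCardEq (by rwa [Fintype.card_fin])), Fintype.card_fin]
  · rw [Fintype.card_eq_zero_iff]
    exact ⟨fun e => h (by rw [← Fintype.card_congr e, Fintype.card_fin])⟩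

theorem hasSum_words {α β K : Type*} [Fintype α] [Fintype β] [DecidableEq β] [Field K] [CharZero K]
    [TopologicalSpace K] [ContinuousAdd K] {T : ∀ n, (Fin n → α × β) → K}
    {U : (β → Option α) → K}
    (hzero : ∀ n w, ¬ Function.Injective (fun k => (w k).2) → T n w = 0)
    (hU : ∀ n w, Function.Injective (fun k => (w k).2) → T n w = U (partialMapOf w)) :
    HasSum (fun n : ℕ => 1 / (n.factorial : K) * ∑ w, T n w) (∑ g, U g) := by
  classical
  suffices h : ∀ n, 1 / (n.factorial : K) * ∑ w, T n w =
      ∑ g, if n = Fintype.card {s // (g s).isSome} then U g else 0 by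
    simp only [h]
    exact hasSum_sum fun g _ => hasSum_ite_eq _ (U g)
  intro n
  have sum_injective : ∑ w, T n w =
      ∑ w : Fin n → α × β with Function.Injective fun k => (w k).2, U (partialMapOf w) := by
    rw [sum_filter]
    exact sum_congr rfl fun w _ => by split_ifs with hw; exacts [hU n w hw, hzero n w hw]
  rw [sum_injective, ← sum_fiberwise _ partialMapOf, mul_sum]
  refine sum_congr rfl fun g _ => ?_
  rw [sum_congr rfl fun w hw => congrArg U (mem_filter.1 hw).2, sum_const, filter_filter,
    card_words_eq, nsmul_eq_mul]
  split_ifs <;> simp [n.factorial_ne_zero]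

/-! ### Exchanging nodes -/

@[to_additive]
theorem prod_extend_mul_prod {ι κ γ A : Type*} [Fintype ι] [CommMonoid A]
    {f : ι → κ} (hf : Function.Injective f) {S : Finset κ} (hS : ∀ k, f k ∈ S) (g : ι → γ)
    (e : κ → γ) (H : κ → γ → A) :
    (∏ s ∈ S, H s (Function.extend f g e s)) * ∏ k, H (f k) (e (f k)) =
      (∏ s ∈ S, H s (e s)) * ∏ k, H (f k) (g k) := by
  classical
  have prod_split (u : κ → A) : ∏ s ∈ S, u s = (∏ s ∈ S \ univ.image f, u s) * ∏ k, u (f k) := by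
    rw [← prod_sdiff (image_subset_iff.2 fun k _ => hS k), prod_image hf.injOn]
  have prod_rest : ∏ s ∈ S \ univ.image f, H s (Function.extend f g e s) =
      ∏ s ∈ S \ univ.image f, H s (e s) := by
    refine prod_congr rfl fun s hs => ?_
    rw [Function.extend_apply' _ _ _ (by simpa using (mem_sdiff.1 hs).2)]
  rw [prod_split, prod_split fun s => H s (e s), prod_rest]
  simp only [hf.extend_apply]
  exact mul_right_comm _ _ _

theorem extend_eq_update_extend_succ {κ γ : Type*} [DecidableEq κ] {n : ℕ} {s : Fin (n + 1) → κ}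
    (hs : Function.Injective s) (P : Fin (n + 1) → γ) (x : κ → γ) :
    Function.extend s P x = Function.update
      (Function.extend (fun k : Fin n => s k.succ) (fun k => P k.succ) x) (s 0) (P 0) := by
  have hs' := hs.comp (Fin.succ_injective n)
  funext m
  by_cases hm : ∃ k, s k = m
  · obtain ⟨k, rfl⟩ := hm
    rw [hs.extend_apply]
    refine Fin.cases ?_ (fun k => ?_) k
    · rw [Function.update_self]
    · rw [Function.update_of_ne (hs.ne (Fin.succ_ne_zero k))]
      exact (hs'.extend_apply (fun k => P k.succ) x k).symm
  · rw [Function.extend_apply' _ _ _ hm, Function.update_of_ne fun h => hm ⟨0, h.symm⟩,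
      Function.extend_apply' _ _ _ fun ⟨k, hk⟩ => hm ⟨k.succ, hk⟩]

theorem vertexCoeff_succ {n : ℕ} (P Q : Fin (n + 1) → ℂ) :
    vertexCoeff P Q = (∏ l : Fin n, ((P 0 - P l.succ) * (Q 0 - Q l.succ)) /
      ((P 0 - Q l.succ) * (Q 0 - P l.succ))) *
        vertexCoeff (fun k => P k.succ) (fun k => Q k.succ) := by
  simp only [vertexCoeff, Fin.prod_univ_succ (n := n), Fin.prod_Ioi_zero, Fin.prod_Ioi_succ]

theorem vertexCoeff_eq_zero_of_not_injective {n : ℕ} (P : Fin n → ℂ) {Q : Fin n → ℂ}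
    (hQ : ¬ Function.Injective Q) : vertexCoeff P Q = 0 := by
  obtain ⟨k, l, hkl, hlt⟩ : ∃ k l, Q k = Q l ∧ k < l := by
    simp only [Function.Injective, not_forall] at hQ
    obtain ⟨k, l, hkl, hne⟩ := hQ
    exact (Ne.lt_or_gt hne).elim (fun h => ⟨k, l, hkl, h⟩) fun h => ⟨l, k, hkl.symm, h⟩
  refine prod_eq_zero (mem_univ k) (prod_eq_zero (mem_Ioi.2 hlt) ?_)
  rw [hkl, sub_self, mul_zero, zero_div]

theorem prod_crossRatio_mul_vdm_extend {n N : ℕ} {x : Fin N → ℂ} {s : Fin n → Fin N}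
    (hs : Function.Injective s) {j : Fin N} (hj : ∀ k, s k ≠ j) {P : Fin n → ℂ} {p : ℂ}
    (hP : ∀ k, P k ≠ x j) (hp : ∀ m, p ≠ x m) :
    (∏ k, ((p - P k) * (x j - x (s k))) / ((p - x (s k)) * (x j - P k))) *
        vdm (Function.extend s P x) =
      (∏ m ∈ univ.erase j, (x j - x m) / (p - x m)) *
        vdm (Function.update (Function.extend s P x) j p) := by
  have hs_mem (k : Fin n) : s k ∈ univ.erase j := mem_erase.2 ⟨hj k, mem_univ _⟩
  have exchange (z : ℂ) := prod_extend_mul_prod hs hs_mem P x fun _ u => z - u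
  have update := vdm_update_mul_prod (Function.extend s P x) j p
  rw [Function.extend_apply' _ _ _ fun ⟨k, hk⟩ => hj k hk] at update
  have hp_nodes : ∏ m ∈ univ.erase j, (p - x m) ≠ 0 :=
    prod_ne_zero_iff.2 fun m _ => sub_ne_zero.2 (hp m)
  have hp_tail : ∏ k, (p - x (s k)) ≠ 0 := prod_ne_zero_iff.2 fun k _ => sub_ne_zero.2 (hp _)
  have hx_tail : ∏ k, (x j - P k) ≠ 0 :=
    prod_ne_zero_iff.2 fun k _ => sub_ne_zero.2 (hP k).symm
  rw [prod_div_distrib, prod_mul_distrib, prod_mul_distrib, prod_div_distrib, div_mul_eq_mul_div,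
    div_mul_eq_mul_div, div_eq_div_iff (mul_ne_zero hp_tail hx_tail) hp_nodes]
  linear_combination vdm (Function.update (Function.extend s P x) j p) *
      (∏ k, (p - x (s k))) * exchange (x j) -
    (∏ k, (p - x (s k))) * (∏ k, (x j - x (s k))) * update -
    vdm (Function.extend s P x) * (∏ k, (x j - x (s k))) * exchange p

theorem vdm_mul_vertexCoeff {n N : ℕ} {x : Fin N → ℂ} {s : Fin n → Fin N}
    (hs : Function.Injective s) {P : Fin n → ℂ} (hP : ∀ k m, P k ≠ x m) :
    vdm x * vertexCoeff P (x ∘ s) =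
      (∏ k, ∏ m ∈ univ.erase (s k), (x (s k) - x m) / (P k - x m)) *
        vdm (Function.extend s P x) := by
  induction n with
  | zero => simp [vertexCoeff, Function.extend_of_isEmpty]
  | succ n ih =>
    have hs_tail : Function.Injective fun k : Fin n => s k.succ :=
      hs.comp (Fin.succ_injective n)
    have head := prod_crossRatio_mul_vdm_extend hs_tail
      (fun k => hs.ne (Fin.succ_ne_zero k)) (fun k => hP k.succ (s 0)) (hP 0)
    rw [vertexCoeff_succ, Fin.prod_univ_succ, extend_eq_update_extend_succ hs, mul_left_comm,
      mul_right_comm _ _ (vdm _), ← head, mul_right_comm, mul_assoc]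
    exact congrArg (_ * ·) (ih hs_tail fun k => hP k.succ)

/-! ### Dressing a seed -/

/-- The summand attached to the nodes `z` when the dressing operator is expanded, for an arbitrary
seed `F`: a Vandermonde factor, an exponential factor and the seed shifted by `∑ₛ [zₛ]`. -/
noncomputable def dressedTerm (F : Times → ℂ) (t : Times) {N : ℕ} (z : Fin N → ℂ) : ℂ :=
  vdm (fun s => (z s)⁻¹) * Complex.exp (∑ s, eta t (z s)⁻¹) * F (t - ∑ s, miwa (z s))

theorem dressedTerm_comp_perm (F : Times → ℂ) (t : Times) {N : ℕ} (z : Fin N → ℂ)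
    (σ : Equiv.Perm (Fin N)) :
    dressedTerm F t (z ∘ σ) = (σ.sign : ℤ) * dressedTerm F t z := by
  have h := vdm_comp_perm (fun s => (z s)⁻¹) σ
  simp only [dressedTerm, Function.comp_def] at h ⊢
  rw [h, Equiv.sum_comp σ fun s => eta t (z s)⁻¹, Equiv.sum_comp σ fun s => miwa (z s)]
  ring

theorem dressedTerm_eq_zero_of_not_injective (F : Times → ℂ) (t : Times) {N : ℕ} {z : Fin N → ℂ}
    (hz : ¬ Function.Injective z) : dressedTerm F t z = 0 := by
  rw [dressedTerm, vdm_eq_zero_of_not_injective, zero_mul, zero_mul]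
  exact fun h => hz fun r s hrs => h (congrArg _ hrs)

theorem mul_vertexProd_eq_dressedTerm (F : Times → ℂ) (t : Times) {n N : ℕ} {z : Fin N → ℂ}
    {s : Fin n → Fin N} (hs : Function.Injective s) {q : Fin n → ℂ} (hq : ∀ k m, q k ≠ z m) :
    vdm (fun m => (z m)⁻¹) * Complex.exp (∑ m, eta t (z m)⁻¹) *
        vertexProd (fun k => (q k)⁻¹) (fun k => (z (s k))⁻¹) (fun u => F (u - ∑ m, miwa (z m))) t =
      (∏ k, ∏ m ∈ univ.erase (s k), ((z (s k))⁻¹ - (z m)⁻¹) / ((q k)⁻¹ - (z m)⁻¹)) *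
        dressedTerm F t (Function.extend s q z) := by
  have coeff := vdm_mul_vertexCoeff hs (x := fun m => (z m)⁻¹) (P := fun k => (q k)⁻¹)
    fun k m h => hq k m (inv_injective h)
  have hinv : Function.extend s (fun k => (q k)⁻¹) (fun m => (z m)⁻¹) =
      fun m => (Function.extend s q z m)⁻¹ :=
    (funext fun m => Function.apply_extend Inv.inv s z m).symm
  have hS (k : Fin n) : s k ∈ (univ : Finset (Fin N)) := mem_univ _
  have eta_sum := sum_extend_add_sum hs hS q z fun _ u => eta t u⁻¹
  have miwa_sum := sum_extend_add_sum hs hS q z fun _ u => miwa u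
  have shift : t - ∑ k, miwa (q k) + ∑ k, miwa (z (s k)) - ∑ m, miwa (z m) =
      t - ∑ m, miwa (Function.extend s q z m) := by
    rw [← eq_sub_iff_add_eq] at miwa_sum
    rw [miwa_sum]
    abel
  have exponent : ∑ m, eta t (z m)⁻¹ + ∑ k, (eta t (q k)⁻¹ - eta t (z (s k))⁻¹) =
      ∑ m, eta t (Function.extend s q z m)⁻¹ := by
    rw [sum_sub_distrib]
    linear_combination -eta_sum
  rw [hinv, Function.comp_def] at coeff
  simp only [vertexProd, normalOrdered, dressedTerm, inv_inv, shift, ← exponent, Complex.exp_add]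
  linear_combination Complex.exp (∑ m, eta t (z m)⁻¹) *
    Complex.exp (∑ k, (eta t (q k)⁻¹ - eta t (z (s k))⁻¹)) *
    F (t - ∑ m, miwa (Function.extend s q z m)) * coeff

/-- The row of `Bmat` picked in column `s` by a partial map `g`: the row of `p_s` outside the
domain of `g`, and the row of `q_i` where `g` takes the value `i`. -/
def selectRow {M N : ℕ} (g : Fin N → Option (Fin M)) (s : Fin N) : Fin (N + M) :=
  (g s).elim (Fin.castAdd M s) (Fin.natAdd N)

theorem selectRow_injective {N M : ℕ} :
    Function.Injective fun g : Fin N → Option (Fin M) => selectRow g := by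
  intro g g' h
  funext s
  have hs : selectRow g s = selectRow g' s := congrFun h s
  unfold selectRow at hs
  rcases hg : g s with _ | i <;> rcases hg' : g' s with _ | i' <;>
    simp [hg, hg', Fin.ext_iff] at hs ⊢ <;> lia

theorem mem_range_selectRow {N M : ℕ} {f : Fin N → Fin (N + M)}
    (hf : ∀ s i, f s = Fin.castAdd M i → i = s) :
    ∃ g : Fin N → Option (Fin M), selectRow g = f := by
  refine ⟨fun s => Fin.addCases (motive := fun _ => Option (Fin M)) (fun _ => none) some (f s),
    funext fun s => ?_⟩
  induction hr : f s using Fin.addCases with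
  | left i => simp [selectRow, hr, hf s i hr]
  | right i => simp [selectRow, hr]

theorem selectRow_partialMapOf {n M N : ℕ} {w : Fin n → Fin M × Fin N}
    (hw : Function.Injective fun k => (w k).2) :
    selectRow (partialMapOf w) =
      Function.extend (fun k => (w k).2) (fun k => Fin.natAdd N (w k).1) (Fin.castAdd M) := by
  funext s
  by_cases hs : ∃ k, (w k).2 = s
  · obtain ⟨k, rfl⟩ := hs
    rw [selectRow, partialMapOf_apply hw, hw.extend_apply, Option.elim_some]
  · rw [selectRow, partialMapOf, Function.extend_apply' _ _ _ hs, Function.extend_apply' _ _ _ hs,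
      Option.elim_none]

section Bmat

variable {N M : ℕ} (p : Fin (N + M) → ℂ) (A : Matrix (Fin M) (Fin N) ℂ)

theorem Bmat_castAdd (i j : Fin N) : Bmat p A (Fin.castAdd M i) j = if i = j then 1 else 0 := by
  simp [Bmat]

theorem Bmat_natAdd (i : Fin M) (j : Fin N) : Bmat p A (Fin.natAdd N i) j =
    A i j * ∏ m ∈ univ.erase j,
      ((pPart p j)⁻¹ - (pPart p m)⁻¹) / ((qPart p i)⁻¹ - (pPart p m)⁻¹) := by
  simp [Bmat]

theorem sum_prod_Bmat_mul (Φ : (Fin N → Fin (N + M)) → ℂ) :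
    ∑ f, (∏ s, Bmat p A (f s) s) * Φ f =
      ∑ g : Fin N → Option (Fin M), (∏ s, Bmat p A (selectRow g s) s) * Φ (selectRow g) := by
  refine (Fintype.sum_of_injective _ selectRow_injective _ _ (fun f hf => ?_) fun _ => rfl).symm
  obtain ⟨s, i, hs, hi⟩ : ∃ s i, f s = Fin.castAdd M i ∧ i ≠ s := by
    by_contra! h
    exact hf (mem_range_selectRow h)
  rw [prod_eq_zero (mem_univ s), zero_mul]
  rw [hs, Bmat_castAdd, if_neg hi]

theorem prod_Bmat_selectRow_partialMapOf {n : ℕ} {w : Fin n → Fin M × Fin N}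
    (hw : Function.Injective fun k => (w k).2) :
    ∏ s, Bmat p A (selectRow (partialMapOf w) s) s =
      (∏ k, A (w k).1 (w k).2) * ∏ k, ∏ m ∈ univ.erase (w k).2,
        ((pPart p (w k).2)⁻¹ - (pPart p m)⁻¹) / ((qPart p (w k).1)⁻¹ - (pPart p m)⁻¹) := by
  have h := prod_extend_mul_prod hw (fun _ => mem_univ _) (fun k => Fin.natAdd N (w k).1)
    (Fin.castAdd M) fun s r => Bmat p A r s
  simpa only [selectRow_partialMapOf hw, Bmat_castAdd, Bmat_natAdd, if_true, prod_const_one,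
    mul_one, one_mul, prod_mul_distrib] using h

theorem mul_prod_mul_vertexProd_eq (F : Times → ℂ) (t : Times)
    (hp : ∀ i j, qPart p i ≠ pPart p j) {n : ℕ} {w : Fin n → Fin M × Fin N}
    (hw : Function.Injective fun k => (w k).2) :
    vdm (fun j => (pPart p j)⁻¹) * Complex.exp (∑ j, eta t (pPart p j)⁻¹) *
        ((∏ k, A (w k).1 (w k).2) *
          vertexProd (fun k => (qPart p (w k).1)⁻¹) (fun k => (pPart p (w k).2)⁻¹)
            (fun s => F (s - ∑ j, miwa (pPart p j))) t) =
      (∏ s, Bmat p A (selectRow (partialMapOf w) s) s) *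
        dressedTerm F t (p ∘ selectRow (partialMapOf w)) := by
  have nodes : p ∘ selectRow (partialMapOf w) =
      Function.extend (fun k => (w k).2) (fun k => qPart p (w k).1) (pPart p) := by
    rw [selectRow_partialMapOf hw]
    exact funext fun s => Function.apply_extend p _ _ s
  rw [prod_Bmat_selectRow_partialMapOf p A hw, nodes, mul_left_comm, mul_assoc (∏ k, _),
    ← mul_vertexProd_eq_dressedTerm F t hw fun k => hp (w k).1]

theorem vdm_mul_expVertex_eq_sum_minorB (F : Times → ℂ) (t : Times)
    (hp : ∀ i j, qPart p i ≠ pPart p j) :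
    vdm (fun j => (pPart p j)⁻¹) * Complex.exp (∑ j, eta t (pPart p j)⁻¹) *
        expVertex A (fun i => (qPart p i)⁻¹) (fun j => (pPart p j)⁻¹)
          (fun s => F (s - ∑ j, miwa (pPart p j))) t =
      ∑ I ∈ indexSets N M, minorB p A I * dressedTerm F t (p ∘ I) := by
  have words := hasSum_words (U := fun g => (∏ s, Bmat p A (selectRow g s) s) *
      dressedTerm F t (p ∘ selectRow g))
    (T := fun n w => vdm (fun j => (pPart p j)⁻¹) * Complex.exp (∑ j, eta t (pPart p j)⁻¹) *
      ((∏ k, A (w k).1 (w k).2) *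
        vertexProd (fun k => (qPart p (w k).1)⁻¹) (fun k => (pPart p (w k).2)⁻¹)
          (fun s => F (s - ∑ j, miwa (pPart p j))) t))
    (fun n w hw => by
      rw [vertexProd, vertexCoeff_eq_zero_of_not_injective, zero_mul, mul_zero, mul_zero]
      exact fun h => hw fun k l hkl => h (by simp only [hkl]))
    fun n w hw => mul_prod_mul_vertexProd_eq p A F t hp hw
  have cauchyBinet := sum_det_submatrix_mul_alternating (Bmat p A)
    (fun f => dressedTerm F t (p ∘ f)) (fun f => dressedTerm_comp_perm F t (p ∘ f)) fun f hf =>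
      dressedTerm_eq_zero_of_not_injective F t fun h => hf h.of_comp
  rw [expVertex, ← tsum_mul_left]
  simp only [mul_left_comm _ (1 / _ : ℂ), mul_sum _ _ (_ * _)]
  refine words.tsum_eq.trans <| (sum_prod_Bmat_mul p A _).symm.trans <| cauchyBinet.symm.trans <|
    sum_congr ?_ fun _ _ => rfl
  ext I
  rw [indexSets, mem_filter_univ, mem_filter_univ]
  rfl

end Bmat

/-! ### The odd theta function -/

theorem jacobiTheta₂_half_sub (τ : ℂ) :
    jacobiTheta₂ (1 / 2 - τ / 2) τ = jacobiTheta₂ (1 / 2 + τ / 2) τ := by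
  rw [← jacobiTheta₂_neg_left, ← jacobiTheta₂_add_left]
  ring_nf

theorem jacobiTheta₂'_half_sub (τ : ℂ) :
    jacobiTheta₂' (1 / 2 - τ / 2) τ = -jacobiTheta₂' (1 / 2 + τ / 2) τ := by
  rw [← neg_neg (jacobiTheta₂' (1 / 2 - τ / 2) τ), ← jacobiTheta₂'_neg_left,
    ← jacobiTheta₂'_add_left]
  ring_nf

theorem jacobiTheta₂_half_add (τ : ℂ) : jacobiTheta₂ (1 / 2 + τ / 2) τ = 0 := by
  have exp_eq : Complex.exp (-Real.pi * Complex.I * (τ + 2 * (1 / 2 - τ / 2))) = -1 := by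
    rw [show -Real.pi * Complex.I * (τ + 2 * (1 / 2 - τ / 2)) = -(Real.pi * Complex.I) by ring,
      Complex.exp_neg, Complex.exp_pi_mul_I, inv_neg_one]
  have h := jacobiTheta₂_add_left' (1 / 2 - τ / 2) τ
  rw [exp_eq, jacobiTheta₂_half_sub, show 1 / 2 - τ / 2 + τ = 1 / 2 + τ / 2 by ring,
    neg_one_mul] at h
  exact self_eq_neg.1 h

theorem jacobiTheta₂'_term_half_add (n : ℤ) (τ : ℂ) :
    jacobiTheta₂'_term n (1 / 2 + τ / 2) τ = 2 * Real.pi * Complex.I *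
      (n * (-1) ^ n * Complex.exp (Real.pi * Complex.I * (n * (n + 1)) * τ)) := by
  rw [jacobiTheta₂'_term, jacobiTheta₂_term,
    show 2 * Real.pi * Complex.I * n * (1 / 2 + τ / 2) + Real.pi * Complex.I * n ^ 2 * τ =
      n * (Real.pi * Complex.I) + Real.pi * Complex.I * (n * (n + 1)) * τ by ring,
    Complex.exp_add, Complex.exp_int_mul, Complex.exp_pi_mul_I]
  ring

theorem hasSum_jacobiTheta₂'_half_add {τ : ℂ} (hτ : 0 < τ.im) :
    HasSum (fun n : ℕ => 2 * Real.pi * Complex.I *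
      ((2 * n + 1) * (-1) ^ n * Complex.exp (Real.pi * Complex.I * (n * (n + 1)) * τ)))
      (jacobiTheta₂' (1 / 2 + τ / 2) τ) := by
  refine (hasSum_jacobiTheta₂'_term (1 / 2 + τ / 2) hτ).nat_add_neg_add_one.congr_fun fun n => ?_
  have neg_one_zpow : (-1 : ℂ) ^ (-((n : ℤ) + 1)) = -(-1) ^ n := by
    rw [zpow_neg, ← inv_zpow, inv_neg_one, zpow_add_one₀ (by norm_num), zpow_natCast, mul_neg_one]
  rw [jacobiTheta₂'_term_half_add, jacobiTheta₂'_term_half_add, neg_one_zpow, zpow_natCast]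
  push_cast
  ring_nf

theorem norm_jacobiTheta₂'_coeff_le {τ : ℂ} (hτ : 0 < τ.im) (n : ℕ) :
    ‖(2 * n + 1) * (-1) ^ n * Complex.exp (Real.pi * Complex.I * (n * (n + 1)) * τ)‖ ≤
      (3 * Real.exp (-(2 * Real.pi * τ.im))) ^ n := by
  have norm_exp : ‖Complex.exp (Real.pi * Complex.I * (n * (n + 1)) * τ)‖ =
      Real.exp (-(Real.pi * τ.im * (n * (n + 1)))) := by
    rw [Complex.norm_exp]
    congr 1
    simp [Complex.mul_re, Complex.mul_im]
    ring
  have norm_odd : ‖(2 * n + 1 : ℂ)‖ = 2 * n + 1 := by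
    exact_mod_cast Complex.norm_natCast (2 * n + 1)
  have bernoulli : (2 * n + 1 : ℝ) ≤ 3 ^ n := by
    have := one_add_mul_le_pow (a := (2 : ℝ)) (by norm_num) n
    norm_num at this
    linarith
  have two_mul_le : 2 * (n : ℝ) ≤ n * (n + 1) := by
    rcases n.eq_zero_or_pos with rfl | hn
    · simp
    · have : (1 : ℝ) ≤ n := by exact_mod_cast hn
      nlinarith
  rw [norm_mul, norm_mul, norm_exp, norm_odd, norm_pow, norm_neg, norm_one, one_pow, mul_one,
    mul_pow, ← Real.exp_nat_mul]
  refine mul_le_mul bernoulli (Real.exp_le_exp.2 ?_) (Real.exp_pos _).le (by positivity)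
  nlinarith [mul_le_mul_of_nonneg_left two_mul_le (mul_pos Real.pi_pos hτ).le]

theorem jacobiTheta₂'_half_add_ne_zero_of_one_le {τ : ℂ} (hτ : 1 ≤ τ.im) :
    jacobiTheta₂' (1 / 2 + τ / 2) τ ≠ 0 := by
  -- The leading term of the alternating series is `1` and, as `3 e^{-2π} < 1/2`, the other terms
  -- sum to less than `1`.
  have im_pos : 0 < τ.im := by linarith
  set q := 3 * Real.exp (-(2 * Real.pi * τ.im)) with hq
  have q_pos : 0 < q := by positivity
  have q_lt : q < 1 / 2 := by
    have six_lt : 6 < 2 * Real.pi * τ.im := by nlinarith [Real.pi_gt_three]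
    have := Real.add_one_le_exp (2 * Real.pi * τ.im)
    rw [hq, Real.exp_neg, ← div_eq_mul_inv, div_lt_iff₀ (Real.exp_pos _)]
    linarith
  have two_pi_I_ne_zero : (2 * Real.pi * Complex.I : ℂ) ≠ 0 := by
    simp [Real.pi_ne_zero]
  intro h
  have series := hasSum_jacobiTheta₂'_half_add im_pos
  rw [h, ← mul_zero (2 * Real.pi * Complex.I : ℂ), hasSum_mul_left_iff two_pi_I_ne_zero] at series
  have tail := (hasSum_nat_add_iff' 1).2 series
  have geometric : HasSum (fun n : ℕ => q ^ (n + 1)) (q * (1 - q)⁻¹) := by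
    simpa [pow_succ'] using! (hasSum_geometric_of_lt_one q_pos.le (by linarith)).mul_left q
  have le := tail.norm_le_of_bounded geometric fun n => norm_jacobiTheta₂'_coeff_le im_pos (n + 1)
  simp only [sum_range_one, CharP.cast_eq_zero, mul_zero, zero_add, pow_zero, mul_one, zero_mul,
    Complex.exp_zero, zero_sub, norm_neg, norm_one, ← div_eq_mul_inv] at le
  rw [le_div_iff₀ (by linarith)] at le
  linarith

theorem jacobiTheta₂'_half_add_ne_zero {a : ℝ} (ha : 0 < a) :
    jacobiTheta₂' (1 / 2 + Complex.I * a / 2) (Complex.I * a) ≠ 0 := by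
  rcases le_total 1 a with one_le | le_one
  · exact jacobiTheta₂'_half_add_ne_zero_of_one_le (by simpa using one_le)
  have ha' : (a : ℂ) ≠ 0 := by exact_mod_cast ha.ne'
  have hI := Complex.I_ne_zero
  set τ : ℂ := -1 / (Complex.I * a) with hτ
  have im_eq : τ.im = a⁻¹ := by
    rw [hτ, show -1 / (Complex.I * a) = Complex.I * (a⁻¹ : ℝ) by
      rw [div_eq_iff (mul_ne_zero hI ha')]
      push_cast
      field_simp
      exact Complex.I_sq.symm]
    simp
  have nonzero : jacobiTheta₂' (1 / 2 + τ / 2) τ ≠ 0 :=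
    jacobiTheta₂'_half_add_ne_zero_of_one_le (im_eq ▸ (one_le_inv₀ ha).2 le_one)
  have half : (1 / 2 + Complex.I * a / 2) / (Complex.I * a) = 1 / 2 - τ / 2 := by
    rw [hτ]
    field_simp
    ring
  rw [jacobiTheta₂'_functional_equation, half, jacobiTheta₂_half_sub, jacobiTheta₂_half_add,
    jacobiTheta₂'_half_sub, mul_zero, sub_zero, show -Complex.I * (Complex.I * a) = a by
      linear_combination (-(a : ℂ)) * Complex.I_mul_I]
  refine mul_ne_zero (div_ne_zero (mul_ne_zero (one_div_ne_zero ?_) (Complex.exp_ne_zero _))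
    (mul_ne_zero hI ha')) (neg_ne_zero.2 nonzero)
  rw [Complex.cpow_def_of_ne_zero ha']
  exact Complex.exp_ne_zero _

theorem theta11_eq (a b : ℝ) (z : ℂ) : theta11 a b z =
    Complex.exp (Real.pi * Complex.I * modulus a b / 4 + Real.pi * Complex.I * (z + 1 / 2)) *
      jacobiTheta₂ (z + (1 / 2 + modulus a b / 2)) (modulus a b) := by
  rw [theta11, jacobiTheta₂, ← tsum_mul_left]
  refine tsum_congr fun n => ?_
  rw [jacobiTheta₂_term, ← Complex.exp_add]
  ring_nf

theorem theta11_neg (a b : ℝ) (z : ℂ) : theta11 a b (-z) = -theta11 a b z := by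
  rw [theta11, theta11, ← tsum_neg, ← (Equiv.subLeft (-1 : ℤ)).tsum_eq]
  refine tsum_congr fun n => ?_
  rw [← neg_one_mul (Complex.exp _), ← Complex.exp_pi_mul_I, ← Complex.exp_add,
    Complex.exp_eq_exp_iff_exists_int]
  refine ⟨-(n + 1), ?_⟩
  simp only [Equiv.subLeft_apply]
  push_cast
  ring

theorem theta11_zero (a b : ℝ) : theta11 a b 0 = 0 :=
  self_eq_neg.1 <| by simpa only [neg_zero] using theta11_neg a b 0

theorem mul_thetaQuot (a b : ℝ) (u : ℂ) : u * thetaQuot a b u = theta11 a b (u / twoω₁ b) := by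
  simpa [theta11_zero] using! sub_smul_dslope (fun u => theta11 a b (u / twoω₁ b)) 0 u

theorem thetaQuot_neg (a b : ℝ) (u : ℂ) : thetaQuot a b (-u) = thetaQuot a b u := by
  rcases eq_or_ne u 0 with rfl | hu
  · rw [neg_zero]
  · refine mul_left_cancel₀ (neg_ne_zero.2 hu) ?_
    rw [mul_thetaQuot, neg_div, theta11_neg, ← mul_thetaQuot, neg_mul]

section

variable {a b : ℝ}

theorem thetaQuot_ne_zero {u : ℂ} (hu : theta11 a b (u / twoω₁ b) ≠ 0) : thetaQuot a b u ≠ 0 :=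
  right_ne_zero_of_mul (mul_thetaQuot a b u ▸ hu)

theorem ne_zero_of_theta11_ne_zero {u : ℂ} (hu : theta11 a b (u / twoω₁ b) ≠ 0) : u ≠ 0 :=
  left_ne_zero_of_mul (mul_thetaQuot a b u ▸ hu)

theorem twoω₁_ne_zero (hb : 0 < b) : twoω₁ b ≠ 0 :=
  neg_ne_zero.2 (mul_ne_zero Complex.I_ne_zero (by exact_mod_cast hb.ne'))

variable (ha : 0 < a) (hb : 0 < b)

include ha hb

theorem modulus_im_pos : 0 < (modulus a b).im := by
  simp [modulus_eq a hb, ha]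

theorem differentiable_theta : Differentiable ℂ (theta a b) :=
  fun z => differentiableAt_jacobiTheta₂_fst z (modulus_im_pos ha hb)

theorem differentiable_theta11 : Differentiable ℂ (theta11 a b) := by
  have := differentiable_theta ha hb
  unfold theta at this
  rw [funext (theta11_eq a b)]
  fun_prop

theorem differentiable_thetaQuot : Differentiable ℂ (thetaQuot a b) := by
  have := differentiable_theta11 ha hb
  have h : Differentiable ℂ fun u => theta11 a b (u / twoω₁ b) := by fun_prop
  exact differentiableOn_univ.1 <|
    (Complex.differentiableOn_dslope univ_mem).2 h.differentiableOn

theorem deriv_theta11_zero_ne_zero : deriv (theta11 a b) 0 ≠ 0 := by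
  have exp_diff : DifferentiableAt ℂ (fun z : ℂ => Complex.exp (Real.pi * Complex.I * modulus a b /
      4 + Real.pi * Complex.I * (z + 1 / 2))) 0 := by fun_prop
  have theta_deriv : HasDerivAt (fun z => jacobiTheta₂ (z + (1 / 2 + modulus a b / 2))
      (modulus a b)) (jacobiTheta₂' (1 / 2 + modulus a b / 2) (modulus a b)) 0 := by
    refine HasDerivAt.comp_add_const (f := fun z => jacobiTheta₂ z (modulus a b)) 0 _ ?_
    rw [zero_add]
    exact hasDerivAt_jacobiTheta₂_fst _ (modulus_im_pos ha hb)
  rw [funext (theta11_eq a b), (exp_diff.hasDerivAt.fun_mul theta_deriv).deriv, zero_add,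
    jacobiTheta₂_half_add, mul_zero, zero_add, modulus_eq a hb]
  exact mul_ne_zero (Complex.exp_ne_zero _) (jacobiTheta₂'_half_add_ne_zero ha)

theorem thetaQuot_zero_ne_zero : thetaQuot a b 0 ≠ 0 := by
  rw [thetaQuot, dslope_same]
  simp only [div_eq_inv_mul]
  rw [deriv_comp_mul_left, mul_zero, smul_eq_mul]
  exact mul_ne_zero (inv_ne_zero (twoω₁_ne_zero hb)) (deriv_theta11_zero_ne_zero ha hb)

end

/-! ### Power series in the times -/

/-- The coefficients `(-1)^{k-1} f^{(k-1)}(w) / (k-1)!`, for `k ≥ 1`, of the expansion of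
`f (w - z)` in powers of `z`; for `f = F'` these are the `F_k(w)`. -/
noncomputable def altTaylorCoeff (f : ℂ → ℂ) (k : ℕ+) (w : ℂ) : ℂ :=
  (-1) ^ ((k : ℕ) - 1) / (((k : ℕ) - 1).factorial : ℂ) * iteratedDeriv ((k : ℕ) - 1) f w

/-- The series `∑ₖ tₖ (-1)^{k-1} f^{(k-1)}(w) / (k-1)!`; for `f = F'` it is `∑ₖ tₖ F_k(w)`. -/
noncomputable def timeSeries (f : ℂ → ℂ) (t : Times) (w : ℂ) : ℂ :=
  ∑' k : ℕ+, t k * altTaylorCoeff f k w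

theorem altTaylorCoeff_congr {f g : ℂ → ℂ} {w : ℂ} (h : f =ᶠ[𝓝 w] g) (k : ℕ+) :
    altTaylorCoeff f k w = altTaylorCoeff g k w := by
  rw [altTaylorCoeff, h.iteratedDeriv_eq, altTaylorCoeff]

theorem altTaylorCoeff_add {f g : ℂ → ℂ} {w : ℂ} (hf : AnalyticAt ℂ f w) (hg : AnalyticAt ℂ g w)
    (k : ℕ+) :
    altTaylorCoeff (f + g) k w = altTaylorCoeff f k w + altTaylorCoeff g k w := by
  rw [altTaylorCoeff, iteratedDeriv_add hf.contDiffAt hg.contDiffAt, mul_add, altTaylorCoeff,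
    altTaylorCoeff]

theorem altTaylorCoeff_inv (k : ℕ+) (w : ℂ) : altTaylorCoeff Inv.inv k w = w⁻¹ ^ (k : ℕ) := by
  have sign : ((-1 : ℂ) ^ ((k : ℕ) - 1)) * (-1) ^ ((k : ℕ) - 1) = 1 := by
    rw [← mul_pow, neg_one_mul, neg_neg, one_pow]
  have exponent : (-1 - ((k : ℕ) - 1 : ℕ) : ℤ) = -(k : ℕ) := by
    rw [Nat.cast_pred k.pos]
    ring
  have := Nat.cast_ne_zero (R := ℂ).2 (Nat.factorial_ne_zero ((k : ℕ) - 1))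
  rw [altTaylorCoeff, iteratedDeriv_eq_iterate, iter_deriv_inv, exponent, zpow_neg, zpow_natCast,
    inv_pow]
  field_simp
  rw [sq, sign]

theorem iteratedDeriv_iteratedDeriv {𝕜 F : Type*} [NontriviallyNormedField 𝕜]
    [NormedAddCommGroup F] [NormedSpace 𝕜 F] (m n : ℕ) (f : 𝕜 → F) :
    iteratedDeriv m (iteratedDeriv n f) = iteratedDeriv (m + n) f := by
  simp only [iteratedDeriv_eq_iterate, Function.iterate_add_apply]

theorem hasSum_miwa_mul_iteratedDeriv {f : ℂ → ℂ} {c z : ℂ} {r : ℝ}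
    (hf : DifferentiableOn ℂ f (Metric.ball c r)) (hz : ‖z‖ < r) :
    HasSum (fun k : ℕ+ => miwa z k * (iteratedDeriv k f c / (((k : ℕ) - 1).factorial : ℂ)))
      (f (c + z) - f c) := by
  have taylor := Complex.hasSum_taylorSeries_on_ball hf (z := c + z) (by simpa using hz)
  simp only [add_sub_cancel_left, smul_eq_mul, ← mul_assoc] at taylor
  have taylor_pnat := (hasSum_pnat_iff (f := fun k : ℕ =>
    (k.factorial : ℂ)⁻¹ * z ^ k * iteratedDeriv k f c) (a := f (c + z) - f c)).2
    (by simpa using taylor)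
  refine taylor_pnat.congr_fun fun k => ?_
  rw [miwa, ← Nat.mul_factorial_pred k.ne_zero, Nat.cast_mul]
  field_simp

theorem miwa_neg (z : ℂ) (k : ℕ+) : miwa (-z) k = (-1) ^ (k : ℕ) * miwa z k := by
  rw [miwa, miwa, neg_pow, mul_div_assoc]

theorem hasSum_miwa_mul_altTaylorCoeff_deriv {f : ℂ → ℂ} {c z : ℂ} {r : ℝ}
    (hf : DifferentiableOn ℂ f (Metric.ball c r)) (hz : ‖z‖ < r) :
    HasSum (fun k : ℕ+ => miwa z k * altTaylorCoeff (deriv f) k c) (f c - f (c - z)) := by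
  have h := (hasSum_miwa_mul_iteratedDeriv hf (z := -z) (by rwa [norm_neg])).neg
  rw [neg_sub, ← sub_eq_add_neg] at h
  refine h.congr_fun fun k => ?_
  rw [miwa_neg, altTaylorCoeff, ← iteratedDeriv_succ', Nat.sub_add_cancel k.pos,
    ← pow_sub_one_mul k.ne_zero (-1 : ℂ)]
  ring

section Holomorphic

variable {f : ℂ → ℂ} {U : Set ℂ} (hU : IsOpen U) (hf : DifferentiableOn ℂ f U)

include hU hf

theorem differentiableOn_iteratedDeriv (n : ℕ) : DifferentiableOn ℂ (iteratedDeriv n f) U := by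
  induction n with
  | zero => rwa [iteratedDeriv_zero]
  | succ n ih =>
    rw [iteratedDeriv_succ]
    exact ih.deriv hU

theorem differentiableOn_altTaylorCoeff (k : ℕ+) : DifferentiableOn ℂ (altTaylorCoeff f k) U :=
  (differentiableOn_iteratedDeriv hU hf _).const_mul _

theorem exists_norm_altTaylorCoeff_le {w₀ : ℂ} (hw₀ : w₀ ∈ U) :
    ∃ δ > 0, ∃ C ρ : ℝ, ∀ w ∈ Metric.ball w₀ δ, w ∈ U ∧
      ∀ k : ℕ+, ‖altTaylorCoeff f k w‖ ≤ C * ρ ^ (k : ℕ) := by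
  obtain ⟨ε, hε, hball⟩ := Metric.nhds_basis_closedBall.mem_iff.1 (hU.mem_nhds hw₀)
  obtain ⟨δ, rfl⟩ : ∃ δ, ε = 2 * δ := ⟨ε / 2, by ring⟩
  have hδ : 0 < δ := by linarith
  obtain ⟨C, hC⟩ := (isCompact_closedBall w₀ (2 * δ)).exists_bound_of_continuousOn
    (hf.continuousOn.mono hball)
  have hsub : ∀ w ∈ Metric.ball w₀ δ, Metric.closedBall w δ ⊆ Metric.closedBall w₀ (2 * δ) :=
    fun w hw => Metric.closedBall_subset_closedBall' (by linarith [Metric.mem_ball.1 hw])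
  refine ⟨δ, hδ, C * δ, δ⁻¹, fun w hw =>
    ⟨hball (hsub w hw (Metric.mem_closedBall_self hδ.le)), fun k => ?_⟩⟩
  have cauchy := Complex.norm_iteratedDeriv_le_of_forall_mem_sphere_norm_le ((k : ℕ) - 1) hδ
    (f := f) (c := w) (C := C)
    (hf.mono ((closure_ball w hδ.ne').trans_subset ((hsub w hw).trans hball))).diffContOnCl
    fun z hz => hC z (hsub w hw (Metric.sphere_subset_closedBall hz))
  have factorial_pos : (0 : ℝ) < ((k : ℕ) - 1).factorial := by positivity
  rw [altTaylorCoeff, norm_mul, norm_div, norm_pow, norm_neg, norm_one, one_pow,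
    Complex.norm_natCast, div_mul_eq_mul_div, one_mul, div_le_iff₀ factorial_pos]
  refine cauchy.trans_eq ?_
  rw [← mul_pow_sub_one k.ne_zero δ⁻¹, inv_pow]
  field_simp

theorem summable_mul_altTaylorCoeff {t : Times} (ht : IsEntireTimes t) {w : ℂ} (hw : w ∈ U) :
    Summable fun k : ℕ+ => t k * altTaylorCoeff f k w := by
  obtain ⟨δ, hδ, C, ρ, h⟩ := exists_norm_altTaylorCoeff_le hU hf hw
  refine Summable.of_norm_bounded ((ht ρ).mul_left C) fun k => ?_
  rw [norm_mul, mul_left_comm]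
  gcongr
  exact (h w (Metric.mem_ball_self hδ)).2 k

theorem differentiableAt_timeSeries_dilate {t : Times} (ht : IsEntireTimes t) {x l₀ : ℂ}
    (hx : l₀ * x ∈ U) : DifferentiableAt ℂ (fun l => timeSeries f (dilate l t) (l * x)) l₀ := by
  obtain ⟨δ, hδ, C, ρ, h⟩ := exists_norm_altTaylorCoeff_le hU hf hx
  set V : Set ℂ := (fun l => l * x) ⁻¹' Metric.ball (l₀ * x) δ ∩
    Metric.ball 0 (‖l₀‖ + 1)
  have hVo : IsOpen V := (Metric.isOpen_ball.preimage (by fun_prop)).inter Metric.isOpen_ball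
  have hmem : l₀ ∈ V := ⟨Metric.mem_ball_self hδ, by simp⟩
  have hV : DifferentiableOn ℂ (fun l => timeSeries f (dilate l t) (l * x)) V := by
    refine Complex.differentiableOn_tsum_of_summable_norm ((ht ((‖l₀‖ + 1) * ρ)).mul_left C)
      (fun k => DifferentiableOn.mul ?_ ?_) hVo fun k l hl => ?_
    · simp only [dilate]
      fun_prop
    · exact (differentiableOn_altTaylorCoeff hU hf k).comp (f := fun l : ℂ => l * x) (by fun_prop)
        fun l hl => (h _ hl.1).1
    · have hl' : ‖l‖ ≤ ‖l₀‖ + 1 := (mem_ball_zero_iff.1 hl.2).le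
      rw [norm_mul, dilate, norm_mul, norm_pow]
      calc ‖l‖ ^ (k : ℕ) * ‖t k‖ * ‖altTaylorCoeff f k (l * x)‖
          ≤ (‖l₀‖ + 1) ^ (k : ℕ) * ‖t k‖ * (C * ρ ^ (k : ℕ)) := by
            gcongr
            exact (h _ hl.1).2 k
        _ = C * (‖t k‖ * ((‖l₀‖ + 1) * ρ) ^ (k : ℕ)) := by
            rw [mul_pow]
            ring
  exact hV.differentiableAt (hVo.mem_nhds hmem)

end Holomorphic

theorem countable_zeros {f : ℂ → ℂ} (hf : Differentiable ℂ f) {z₀ : ℂ} (hz₀ : f z₀ ≠ 0) :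
    {z | f z = 0}.Countable := by
  have analytic : AnalyticOnNhd ℂ f Set.univ := fun z _ => hf.analyticAt z
  have discrete := (mem_codiscrete'.1 (analytic.preimage_zero_mem_codiscrete hz₀)).2
  rw [Set.preimage_compl, compl_compl] at discrete
  exact (HereditarilyLindelofSpace.isLindelof _).countable_of_isDiscrete discrete

/-! ### Local logarithms of an even function -/

theorem logDeriv_neg_of_even {𝕜 : Type*} [NontriviallyNormedField 𝕜] {E : 𝕜 → 𝕜}
    (hE : ∀ u, E (-u) = E u) (u : 𝕜) :
    logDeriv E (-u) = -logDeriv E u := by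
  have h : deriv (fun v => E (-v)) u = -deriv E (-u) := deriv_comp_neg E u
  rw [funext hE] at h
  rw [logDeriv_apply, logDeriv_apply, hE, h, neg_div, neg_neg]

theorem differentiableOn_logDeriv {E : ℂ → ℂ} (hE : Differentiable ℂ E) :
    DifferentiableOn ℂ (logDeriv E) {u | E u ≠ 0} := fun u hu =>
  ((hE.deriv u).div (hE u) hu).differentiableWithinAt

theorem exists_even_log {E : ℂ → ℂ} {r : ℝ} (hr : 0 < r)
    (hE : DifferentiableOn ℂ E (Metric.ball 0 r)) (hne : ∀ u ∈ Metric.ball 0 r, E u ≠ 0)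
    (heven : ∀ u, E (-u) = E u) :
    ∃ Λ : ℂ → ℂ, ∀ u ∈ Metric.ball 0 r,
      HasDerivAt Λ (logDeriv E u) u ∧ Complex.exp (Λ u) = E u ∧ Λ (-u) = Λ u := by
  have isOpen := Metric.isOpen_ball (x := (0 : ℂ)) (ε := r)
  have preconnected : IsPreconnected (Metric.ball (0 : ℂ) r) := (convex_ball _ _).isPreconnected
  have zero_mem : (0 : ℂ) ∈ Metric.ball 0 r := Metric.mem_ball_self hr
  have neg_mem : ∀ u ∈ Metric.ball (0 : ℂ) r, -u ∈ Metric.ball 0 r := by simp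
  have hlog : DifferentiableOn ℂ (logDeriv E) (Metric.ball 0 r) := (hE.deriv isOpen).div hE hne
  obtain ⟨Λ, Λ_zero, hΛ⟩ := hlog.isExactOn_ball.with_val_at 0 (Complex.log (E 0))
  have differentiable : DifferentiableOn ℂ Λ (Metric.ball 0 r) := fun u hu =>
    (hΛ u hu).differentiableAt.differentiableWithinAt
  have exp_eq : Set.EqOn (Complex.exp ∘ Λ) E (Metric.ball 0 r) := by
    obtain ⟨c, -, hc⟩ := (logDeriv_eqOn_iff differentiable.cexp hE isOpen preconnected hne
      fun u _ => Complex.exp_ne_zero _).1 fun u hu => by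
        rw [logDeriv_apply, (hΛ u hu).cexp.deriv, mul_div_cancel_left₀ _ (Complex.exp_ne_zero _)]
    have hc0 := hc zero_mem
    simp only [Pi.smul_apply, smul_eq_mul, Λ_zero, Complex.exp_log (hne 0 zero_mem)] at hc0
    obtain rfl := mul_right_cancel₀ (hne 0 zero_mem) ((one_mul _).trans hc0).symm
    rwa [one_smul] at hc
  have even : Set.EqOn (fun u => Λ (-u)) Λ (Metric.ball 0 r) := by
    have deriv_neg : ∀ u ∈ Metric.ball (0 : ℂ) r,
        HasDerivAt (fun v => Λ (-v)) (logDeriv E u) u := fun u hu => by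
      convert! (hΛ (-u) (neg_mem u hu)).comp u (hasDerivAt_neg u) using 1
      rw [logDeriv_neg_of_even heven, neg_mul_neg, mul_one]
    refine isOpen.eqOn_of_deriv_eq preconnected (fun u hu =>
      (deriv_neg u hu).differentiableAt.differentiableWithinAt) differentiable
      (fun u hu => ?_) zero_mem (by simp)
    rw [(deriv_neg u hu).deriv, (hΛ u hu).deriv]
  exact ⟨Λ, fun u hu => ⟨hΛ u hu, exp_eq hu, even hu⟩⟩

/-! ### Bilinear forms in the times -/

/-- The times `t` for which `η(t, z)` converges absolutely at `z = r`. -/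
noncomputable def tameTimes (r : ℝ) : Submodule ℂ Times where
  carrier := {t | Summable fun k : ℕ+ => t k * (r : ℂ) ^ (k : ℕ)}
  add_mem' hs ht := by simpa only [Set.mem_ofPred_eq, Pi.add_apply, add_mul] using hs.add ht
  zero_mem' := by simp [summable_zero]
  smul_mem' c t ht := by
    simpa only [Set.mem_ofPred_eq, Pi.smul_apply, smul_eq_mul, mul_assoc] using ht.mul_left c

theorem IsEntireTimes.mem_tameTimes {t : Times} (ht : IsEntireTimes t) (r : ℝ) :
    t ∈ tameTimes r :=
  ht.summable_eta r

theorem IsEntireTimes.dilate {t : Times} (ht : IsEntireTimes t) (l : ℂ) :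
    IsEntireTimes (dilate l t) := by
  refine fun r => (ht (‖l‖ * r)).congr fun k => ?_
  rw [EllipticKP.dilate, norm_mul, norm_pow, mul_pow]
  ring

theorem miwa_mem_tameTimes {ρ : ℝ} {z : ℂ} (hz : ‖z‖ < ρ) : miwa z ∈ tameTimes ρ⁻¹ := by
  have hρ : 0 < ρ := (norm_nonneg z).trans_lt hz
  refine (hasSum_eta_miwa ?_).summable
  rwa [Complex.ofReal_inv, norm_mul, norm_inv, Complex.norm_of_nonneg hρ.le, ← div_eq_mul_inv,
    div_lt_one hρ]

/-- The bilinear form `∑_{i,j} c_{ij} sᵢ tⱼ`. -/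
noncomputable def timesForm (c : ℕ+ → ℕ+ → ℂ) (s t : Times) : ℂ :=
  ∑' ij : ℕ+ × ℕ+, c ij.1 ij.2 * s ij.1 * t ij.2

section Form

variable {c : ℕ+ → ℕ+ → ℂ} {C r : ℝ}

theorem timesForm_comm (hsymm : ∀ i j, c i j = c j i) (s t : Times) :
    timesForm c s t = timesForm c t s := by
  rw [timesForm, timesForm, ← (Equiv.prodComm ℕ+ ℕ+).tsum_eq]
  refine tsum_congr fun ij => ?_
  rw [Equiv.prodComm_apply, Prod.fst_swap, Prod.snd_swap, hsymm]
  ring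

variable (hr : 0 ≤ r) (hc : ∀ i j : ℕ+, ‖c i j‖ ≤ C * (r ^ (i : ℕ) * r ^ (j : ℕ)))

include hr hc

theorem summable_timesForm {s t : Times} (hs : s ∈ tameTimes r) (ht : t ∈ tameTimes r) :
    Summable fun ij : ℕ+ × ℕ+ => c ij.1 ij.2 * s ij.1 * t ij.2 := by
  have product := (hs.norm.mul_of_nonneg ht.norm (fun k => norm_nonneg _)
    fun k => norm_nonneg _).mul_left C
  refine product.of_norm_bounded fun ij => ?_
  simp only [norm_mul, norm_pow, Complex.norm_of_nonneg hr]
  calc ‖c ij.1 ij.2‖ * ‖s ij.1‖ * ‖t ij.2‖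
      ≤ C * (r ^ (ij.1 : ℕ) * r ^ (ij.2 : ℕ)) * ‖s ij.1‖ * ‖t ij.2‖ := by
        gcongr
        exact hc _ _
    _ = _ := by ring

/-- `timesForm c` as a bilinear form on the times on which it converges absolutely. -/
noncomputable def tameTimesForm : LinearMap.BilinForm ℂ (tameTimes r) :=
  LinearMap.mk₂ ℂ (fun s t => timesForm c s t)
    (fun s s' t => by
      rw [timesForm, timesForm, timesForm, ← (summable_timesForm hr hc s.2 t.2).tsum_add
        (summable_timesForm hr hc s'.2 t.2)]
      simp only [Submodule.coe_add, Pi.add_apply, mul_add, add_mul])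
    (fun a s t => by
      rw [timesForm, timesForm, smul_eq_mul, ← tsum_mul_left]
      simp only [Submodule.coe_smul, Pi.smul_apply, smul_eq_mul, mul_assoc, mul_left_comm])
    (fun s t t' => by
      rw [timesForm, timesForm, timesForm, ← (summable_timesForm hr hc s.2 t.2).tsum_add
        (summable_timesForm hr hc s.2 t'.2)]
      simp only [Submodule.coe_add, Pi.add_apply, mul_add])
    (fun a s t => by
      rw [timesForm, timesForm, smul_eq_mul, ← tsum_mul_left]
      simp only [Submodule.coe_smul, Pi.smul_apply, smul_eq_mul, mul_left_comm])

end Form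

theorem bilinForm_sub_sum {R V ι : Type*} [CommRing R] [AddCommGroup V] [Module R V]
    (B : LinearMap.BilinForm R V) (hB : ∀ x y, B x y = B y x) (S : Finset ι) (f : ι → V) (x : V) :
    B (x - ∑ i ∈ S, f i) (x - ∑ i ∈ S, f i) =
      B x x - 2 * ∑ i ∈ S, B x (f i) + ∑ i ∈ S, ∑ j ∈ S, B (f i) (f j) := by
  simp only [map_sub, map_sum, LinearMap.sub_apply, LinearMap.sum_apply, sum_sub_distrib, hB _ x]
  rw [sum_comm]
  ring

theorem sum_sum_of_symm {ι R : Type*} [Fintype ι] [LinearOrder ι] [LocallyFiniteOrderTop ι]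
    [LocallyFiniteOrderBot ι] [CommRing R] (f : ι → ι → R) (hf : ∀ i j, f i j = f j i) :
    ∑ i, ∑ j, f i j = ∑ i, f i i + 2 * ∑ i, ∑ j ∈ Ioi i, f i j := by
  have split_diag : ∀ i, ∑ j, f i j = f i i + ∑ j ∈ {i}ᶜ, f j i := fun i => by
    rw [← sum_add_sum_compl {i}, sum_singleton]
    exact congrArg (f i i + ·) (sum_congr rfl fun j _ => hf i j)
  simp only [split_diag, sum_add_distrib, ← sum_sum_Ioi_add_eq_sum_sum_off_diag, two_mul]
  congr 2
  exact sum_congr rfl fun i _ => sum_congr rfl fun j _ => hf j i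

theorem timesForm_sub_sum_div_two {c : ℕ+ → ℕ+ → ℂ} {C r : ℝ} (hr : 0 ≤ r)
    (hc : ∀ i j : ℕ+, ‖c i j‖ ≤ C * (r ^ (i : ℕ) * r ^ (j : ℕ))) (hsymm : ∀ i j, c i j = c j i)
    {ι : Type*} [Fintype ι] [LinearOrder ι] [LocallyFiniteOrderTop ι] [LocallyFiniteOrderBot ι]
    {t : Times} (ht : t ∈ tameTimes r) {f : ι → Times} (hf : ∀ i, f i ∈ tameTimes r) :
    timesForm c (t - ∑ i, f i) (t - ∑ i, f i) / 2 =
      timesForm c t t / 2 - ∑ i, timesForm c t (f i) +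
        (∑ i, timesForm c (f i) (f i) / 2 + ∑ i, ∑ j ∈ Ioi i, timesForm c (f i) (f j)) := by
  lift t to tameTimes r using ht
  lift f to ι → tameTimes r using hf
  have h := bilinForm_sub_sum (tameTimesForm hr hc) (fun s t => timesForm_comm hsymm s t) univ f t
  simp only [tameTimesForm, LinearMap.mk₂_apply, AddSubgroupClass.coe_sub,
    AddSubmonoidClass.coe_finsetSum] at h
  rw [sum_sum_of_symm _ fun i j => timesForm_comm hsymm (f i) (f j)] at h
  simp only [h, ← sum_div]
  ring

/-! ### The form of a second kind kernel -/

/-- The coefficient of `z₁^{i-1} z₂^{j-1}` in the Taylor expansion of `-ζ'(z₂ - z₁)`. -/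
noncomputable def kernelCoeff (ζ : ℂ → ℂ) (i j : ℕ+) : ℂ :=
  -(iteratedDeriv j (altTaylorCoeff ζ i) 0 / (((j : ℕ) - 1).factorial : ℂ))

theorem kernelCoeff_eq (ζ : ℂ → ℂ) (i j : ℕ+) :
    kernelCoeff ζ i j = -((-1) ^ ((i : ℕ) - 1) * iteratedDeriv ((i : ℕ) - 1 + j) ζ 0 /
      ((((i : ℕ) - 1).factorial : ℂ) * (((j : ℕ) - 1).factorial : ℂ))) := by
  have h : altTaylorCoeff ζ i = fun w => (-1) ^ ((i : ℕ) - 1) / (((i : ℕ) - 1).factorial : ℂ) *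
    iteratedDeriv ((i : ℕ) - 1) ζ w := rfl
  rw [kernelCoeff, h, iteratedDeriv_const_mul_field, iteratedDeriv_iteratedDeriv,
    add_comm (j : ℕ)]
  ring

theorem kernelCoeff_symm {ζ : ℂ → ℂ} (hodd : ∀ u, ζ (-u) = -ζ u) (i j : ℕ+) :
    kernelCoeff ζ i j = kernelCoeff ζ j i := by
  obtain ⟨m, hm⟩ : ∃ m, (i : ℕ) = m + 1 := ⟨i - 1, (Nat.sub_add_cancel i.pos).symm⟩
  obtain ⟨n, hn⟩ : ∃ n, (j : ℕ) = n + 1 := ⟨j - 1, (Nat.sub_add_cancel j.pos).symm⟩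
  have parity := iteratedDeriv_comp_neg (m + (n + 1)) ζ 0
  rw [funext hodd, iteratedDeriv_fun_neg, neg_zero, smul_eq_mul] at parity
  have sign_eq : (-1) ^ m * iteratedDeriv (m + (n + 1)) ζ 0 =
      (-1) ^ n * iteratedDeriv (m + (n + 1)) ζ 0 := by
    have sq_sign : ((-1 : ℂ) ^ m) ^ 2 = 1 := by rw [← pow_mul', pow_mul]; simp
    linear_combination -(-1) ^ m * parity + (-1) ^ n * iteratedDeriv (m + (n + 1)) ζ 0 * sq_sign
  rw [kernelCoeff_eq, kernelCoeff_eq, hm, hn, Nat.add_sub_cancel, Nat.add_sub_cancel, sign_eq,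
    mul_comm (m.factorial : ℂ), show n + (m + 1) = m + (n + 1) by ring]

theorem hasSum_kernelCoeff_mul_miwa {ζ : ℂ → ℂ} {U : Set ℂ} (hU : IsOpen U)
    (hζ : DifferentiableOn ℂ ζ U) {r : ℝ} (hr : Metric.ball 0 r ⊆ U) (i : ℕ+) {w : ℂ}
    (hw : ‖w‖ < r) :
    HasSum (fun j : ℕ+ => kernelCoeff ζ i j * miwa w j)
      (altTaylorCoeff ζ i 0 - altTaylorCoeff ζ i w) := by
  have taylor := (hasSum_miwa_mul_iteratedDeriv
    ((differentiableOn_altTaylorCoeff hU hζ i).mono hr) hw).neg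
  rw [neg_sub, zero_add] at taylor
  exact taylor.congr_fun fun j => by rw [kernelCoeff, neg_mul, mul_comm]

theorem factorial_add_add_one_le (m n : ℕ) :
    (m + (n + 1)).factorial ≤ 4 ^ (m + (n + 1)) * (m.factorial * n.factorial) := by
  calc (m + n + 1).factorial = (m + n + 1) * ((m + n).choose n * m.factorial * n.factorial) := by
        rw [Nat.factorial_succ, ← Nat.add_choose_mul_factorial_mul_factorial]
    _ ≤ 2 ^ (m + n + 1) * (2 ^ (m + n + 1) * m.factorial * n.factorial) := by
        gcongr
        · exact Nat.lt_two_pow_self.le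
        · exact (Nat.choose_le_two_pow _ _).trans (Nat.pow_le_pow_right two_pos (Nat.le_succ _))
    _ = 4 ^ (m + (n + 1)) * (m.factorial * n.factorial) := by
        rw [← add_assoc, show (4 : ℕ) = 2 * 2 from rfl, mul_pow]
        ring

section Kernel

variable {ζ : ℂ → ℂ} {U : Set ℂ} {ρ : ℝ} (hU : IsOpen U) (hζ : DifferentiableOn ℂ ζ U)
  (hρ : 0 < ρ) (hball : Metric.closedBall 0 (4 * ρ) ⊆ U)

include hρ

include hζ hball in
theorem exists_norm_kernelCoeff_le :
    ∃ C : ℝ, ∀ i j : ℕ+, ‖kernelCoeff ζ i j‖ ≤ C * (ρ⁻¹ ^ (i : ℕ) * ρ⁻¹ ^ (j : ℕ)) := by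
  have hρ4 : 0 < 4 * ρ := by positivity
  obtain ⟨C, hC⟩ := (isCompact_closedBall (0 : ℂ) (4 * ρ)).exists_bound_of_continuousOn
    (hζ.continuousOn.mono hball)
  refine ⟨C * ρ, fun i j => ?_⟩
  obtain ⟨m, hm⟩ : ∃ m, (i : ℕ) = m + 1 := ⟨i - 1, (Nat.sub_add_cancel i.pos).symm⟩
  obtain ⟨n, hn⟩ : ∃ n, (j : ℕ) = n + 1 := ⟨j - 1, (Nat.sub_add_cancel j.pos).symm⟩
  have cauchy := Complex.norm_iteratedDeriv_le_of_forall_mem_sphere_norm_le (m + (n + 1)) hρ4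
    (hζ.mono ((closure_ball (0 : ℂ) hρ4.ne').trans_subset hball)).diffContOnCl
    fun z hz => hC z (Metric.sphere_subset_closedBall hz)
  have factorial_le : ((m + (n + 1)).factorial : ℝ) ≤
      4 ^ (m + (n + 1)) * (m.factorial * n.factorial) := by
    exact_mod_cast factorial_add_add_one_le m n
  have hC0 : 0 ≤ C := (norm_nonneg _).trans (hC 0 (Metric.mem_closedBall_self hρ4.le))
  rw [kernelCoeff_eq, hm, hn, Nat.add_sub_cancel, Nat.add_sub_cancel]
  simp only [norm_div, norm_mul, norm_neg, norm_pow, norm_one, one_pow, one_mul,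
    Complex.norm_natCast]
  rw [div_le_iff₀ (by positivity)]
  calc _ ≤ (m + (n + 1)).factorial * C / (4 * ρ) ^ (m + (n + 1)) := cauchy
    _ ≤ (4 ^ (m + (n + 1)) * (m.factorial * n.factorial)) * C / (4 * ρ) ^ (m + (n + 1)) := by
      gcongr
    _ = _ := by
      simp only [mul_pow, inv_pow, pow_add, pow_one]
      field_simp

include hU hζ hball

theorem hasSum_timesForm_kernelCoeff_miwa {t : Times} (ht : t ∈ tameTimes ρ⁻¹) {w : ℂ}
    (hw : ‖w‖ < ρ) :
    HasSum (fun i : ℕ+ => t i * (altTaylorCoeff ζ i 0 - altTaylorCoeff ζ i w))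
      (timesForm (kernelCoeff ζ) t (miwa w)) := by
  obtain ⟨C, hC⟩ := exists_norm_kernelCoeff_le hζ hρ hball
  have hsub : Metric.ball 0 ρ ⊆ U :=
    (Metric.ball_subset_closedBall.trans (Metric.closedBall_subset_closedBall (by linarith))).trans
      hball
  refine (summable_timesForm (inv_nonneg.2 hρ.le) hC ht
    (miwa_mem_tameTimes hw)).hasSum.prod_fiberwise fun i => ?_
  refine ((hasSum_kernelCoeff_mul_miwa hU hζ hsub i hw).mul_left (t i)).congr_fun fun j => ?_
  ring

theorem timesForm_kernelCoeff_miwa {t : Times} (ht : IsEntireTimes t) {w : ℂ} (hw : ‖w‖ < ρ) :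
    timesForm (kernelCoeff ζ) t (miwa w) = timeSeries ζ t 0 - timeSeries ζ t w := by
  have mem_U : ∀ u : ℂ, ‖u‖ < ρ → u ∈ U := fun u hu => hball (by simpa using by linarith)
  refine (hasSum_timesForm_kernelCoeff_miwa hU hζ hρ hball (ht.mem_tameTimes _) hw).unique ?_
  have sub := (summable_mul_altTaylorCoeff hU hζ ht (mem_U 0 (by simpa))).hasSum.sub
    (summable_mul_altTaylorCoeff hU hζ ht (mem_U w hw)).hasSum
  exact sub.congr_fun fun i => mul_sub _ _ _

theorem timesForm_kernelCoeff_miwa_miwa {Λ : ℂ → ℂ}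
    (hΛ : ∀ u ∈ Metric.ball 0 (2 * ρ), HasDerivAt Λ (ζ u) u) {z w : ℂ} (hz : ‖z‖ < ρ)
    (hw : ‖w‖ < ρ) :
    timesForm (kernelCoeff ζ) (miwa z) (miwa w) = Λ 0 - Λ (-z) - Λ w + Λ (w - z) := by
  have taylor : ∀ c : ℂ, ‖c‖ < ρ →
      HasSum (fun i : ℕ+ => miwa z i * altTaylorCoeff ζ i c) (Λ c - Λ (c - z)) := by
    intro c hc
    have hsub : Metric.ball c ρ ⊆ Metric.ball 0 (2 * ρ) :=
      Metric.ball_subset_ball' (by rw [dist_zero_right]; linarith)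
    have deriv_eq : deriv Λ =ᶠ[𝓝 c] ζ := by
      filter_upwards [Metric.ball_mem_nhds c hρ] with u hu
      exact (hΛ u (hsub hu)).deriv
    refine (hasSum_miwa_mul_altTaylorCoeff_deriv (f := Λ) (c := c) (fun u hu =>
      (hΛ u (hsub hu)).differentiableAt.differentiableWithinAt) hz).congr_fun fun i => ?_
    rw [altTaylorCoeff_congr deriv_eq]
  have h := (hasSum_timesForm_kernelCoeff_miwa hU hζ hρ hball (miwa_mem_tameTimes hz) hw).unique
    (((taylor 0 (by simpa)).sub (taylor w hw)).congr_fun fun i => mul_sub _ _ _)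
  rw [h, zero_sub]
  ring

end Kernel

theorem differentiable_timesForm_dilate {c : ℕ+ → ℕ+ → ℂ} {C r : ℝ} (hr : 0 ≤ r)
    (hc : ∀ i j : ℕ+, ‖c i j‖ ≤ C * (r ^ (i : ℕ) * r ^ (j : ℕ))) {t : Times}
    (ht : IsEntireTimes t) : Differentiable ℂ fun l => timesForm c (dilate l t) (dilate l t) := by
  intro l₀
  set R : ℝ := ‖l₀‖ + 1 with hR
  have norm_R : ‖(R : ℂ)‖ = R := Complex.norm_of_nonneg (by positivity)
  have mem := (ht.dilate R).mem_tameTimes r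
  have differentiableOn : DifferentiableOn ℂ
      (fun l => timesForm c (dilate l t) (dilate l t)) (Metric.ball 0 R) := by
    refine Complex.differentiableOn_tsum_of_summable_norm
      (summable_timesForm hr hc mem mem).norm (fun ij => ?_) Metric.isOpen_ball fun ij l hl => ?_
    · simp only [dilate]
      fun_prop
    · have hl' : ‖l‖ ≤ ‖(R : ℂ)‖ := norm_R.symm ▸ (mem_ball_zero_iff.1 hl).le
      simp only [dilate, norm_mul, norm_pow]
      gcongr
  exact differentiableOn.differentiableAt (Metric.isOpen_ball.mem_nhds (by simp [hR]))

/-! ### Prime form factors -/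

/-- The factor by which shifting the times by `-∑ᵣ [xᵣ]` multiplies `exp(q/2)`, apart from the
exponentials linear in the times, when `u E(u)` is the prime form whose second kind kernel has
the Taylor coefficients of `q`. -/
noncomputable def primeFactor (E : ℂ → ℂ) {N : ℕ} (x : Fin N → ℂ) : ℂ :=
  (∏ r, E 0 / E (x r)) * ∏ r, ∏ s ∈ Ioi r, E (x s - x r) * E 0 / (E (x r) * E (x s))

theorem differentiableAt_primeFactor {E : ℂ → ℂ} (hE : Differentiable ℂ E) {N : ℕ}
    {x : Fin N → ℂ} {l₀ : ℂ} (hx : ∀ r, E (l₀ * x r) ≠ 0) :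
    DifferentiableAt ℂ (fun l => primeFactor E fun r => l * x r) l₀ := by
  have hE' : ∀ c : ℂ, DifferentiableAt ℂ (fun l => E (l * c)) l₀ := fun c => by fun_prop
  refine DifferentiableAt.mul (DifferentiableAt.fun_finsetProd fun r _ => ?_)
    (DifferentiableAt.fun_finsetProd fun r _ => DifferentiableAt.fun_finsetProd fun s _ => ?_)
  · exact (differentiableAt_const _).div (hE' _) (hx r)
  · simp only [← mul_sub]
    exact ((hE' _).mul_const _).div ((hE' _).mul (hE' _)) (mul_ne_zero (hx r) (hx s))

section EvenEntire

variable {E : ℂ → ℂ} {ρ : ℝ} (hE : Differentiable ℂ E) (heven : ∀ u, E (-u) = E u)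
  (hρ : 0 < ρ) (hball : Metric.closedBall 0 (4 * ρ) ⊆ {u | E u ≠ 0})

include hE heven hρ hball

theorem exists_log_timesForm_miwa :
    ∃ Λ : ℂ → ℂ, (∀ u ∈ Metric.ball 0 (2 * ρ), Complex.exp (Λ u) = E u) ∧
      ∀ z w, ‖z‖ < ρ → ‖w‖ < ρ →
        timesForm (kernelCoeff (logDeriv E)) (miwa z) (miwa w) = Λ 0 - Λ z - Λ w + Λ (w - z) := by
  have hsub : Metric.ball (0 : ℂ) (2 * ρ) ⊆ {u | E u ≠ 0} :=
    (Metric.ball_subset_closedBall.trans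
      (Metric.closedBall_subset_closedBall (by linarith))).trans hball
  obtain ⟨Λ, hΛ⟩ := exists_even_log (by linarith) hE.differentiableOn hsub heven
  refine ⟨Λ, fun u hu => (hΛ u hu).2.1, fun z w hz hw => ?_⟩
  rw [timesForm_kernelCoeff_miwa_miwa (isOpen_ne_fun hE.continuous continuous_const)
    (differentiableOn_logDeriv hE) hρ hball (fun u hu => (hΛ u hu).1) hz hw,
    (hΛ z (mem_ball_zero_iff.2 (by linarith))).2.2]

theorem exp_timesForm_miwa {z w : ℂ} (hz : ‖z‖ < ρ) (hw : ‖w‖ < ρ) :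
    Complex.exp (timesForm (kernelCoeff (logDeriv E)) (miwa z) (miwa w)) =
      E (w - z) * E 0 / (E z * E w) := by
  obtain ⟨Λ, hexp, hform⟩ := exists_log_timesForm_miwa hE heven hρ hball
  have hwz : ‖w - z‖ < 2 * ρ := (norm_sub_le w z).trans_lt (by linarith)
  simp only [← mem_ball_zero_iff] at hwz
  rw [hform z w hz hw, Complex.exp_add, Complex.exp_sub, Complex.exp_sub, hexp _ hwz,
    hexp z (mem_ball_zero_iff.2 (by linarith)), hexp w (mem_ball_zero_iff.2 (by linarith)),
    hexp 0 (Metric.mem_ball_self (by linarith))]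
  ring

theorem exp_timesForm_miwa_self_div_two {z : ℂ} (hz : ‖z‖ < ρ) :
    Complex.exp (timesForm (kernelCoeff (logDeriv E)) (miwa z) (miwa z) / 2) = E 0 / E z := by
  obtain ⟨Λ, hexp, hform⟩ := exists_log_timesForm_miwa hE heven hρ hball
  rw [hform z z hz hz, sub_self, show (Λ 0 - Λ z - Λ z + Λ 0) / 2 = Λ 0 - Λ z by ring,
    Complex.exp_sub, hexp z (mem_ball_zero_iff.2 (by linarith)),
    hexp 0 (Metric.mem_ball_self (by linarith))]

theorem exp_timesForm_sub_sum_miwa {N : ℕ} {t : Times} (ht : IsEntireTimes t) {x : Fin N → ℂ}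
    (hx : ∀ r, ‖x r‖ < ρ) :
    Complex.exp (timesForm (kernelCoeff (logDeriv E)) (t - ∑ r, miwa (x r))
        (t - ∑ r, miwa (x r)) / 2) =
      Complex.exp (timesForm (kernelCoeff (logDeriv E)) t t / 2) *
        Complex.exp (∑ r, (timeSeries (logDeriv E) t (x r) - timeSeries (logDeriv E) t 0)) *
        primeFactor E x := by
  have isOpen : IsOpen {u | E u ≠ 0} := isOpen_ne_fun hE.continuous continuous_const
  have hζ := differentiableOn_logDeriv hE
  obtain ⟨C, hC⟩ := exists_norm_kernelCoeff_le hζ hρ hball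
  rw [timesForm_sub_sum_div_two (inv_nonneg.2 hρ.le) hC
    (kernelCoeff_symm (logDeriv_neg_of_even heven)) (ht.mem_tameTimes _)
    fun r => miwa_mem_tameTimes (hx r), sub_eq_add_neg, ← sum_neg_distrib]
  simp only [timesForm_kernelCoeff_miwa isOpen hζ hρ hball ht (hx _), neg_sub, Complex.exp_add,
    Complex.exp_sum, exp_timesForm_miwa_self_div_two hE heven hρ hball (hx _),
    exp_timesForm_miwa hE heven hρ hball (hx _) (hx _), primeFactor]

end EvenEntire

/-! ### The seed -/

theorem dilate_one (t : Times) : dilate 1 t = t := by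
  funext k
  rw [dilate, one_pow, one_mul]

theorem dilate_sub_sum_miwa (l : ℂ) (t : Times) {ι : Type*} (S : Finset ι) (x : ι → ℂ) :
    dilate l (t - ∑ r ∈ S, miwa (x r)) = dilate l t - ∑ r ∈ S, miwa (l * x r) := by
  funext k
  simp only [dilate, Pi.sub_apply, Finset.sum_apply, miwa, mul_sub, mul_sum, mul_pow, mul_div_assoc]

theorem bidiff_eq (a b : ℝ) (z₁ z₂ : ℂ) :
    bidiff a b z₁ z₂ = -deriv (logDeriv (thetaQuot a b)) (z₂ - z₁) := by
  have h : (fun w₁ => logDeriv (fun w₂ => thetaQuot a b (w₂ - w₁)) z₂) =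
      fun w₁ => logDeriv (thetaQuot a b) (z₂ - w₁) := by
    funext w₁
    rw [logDeriv_apply, deriv_comp_sub_const, logDeriv_apply]
  rw [bidiff, h, deriv_comp_const_sub]

theorem qcoef_eq_kernelCoeff (a b : ℝ) : qcoef a b = kernelCoeff (logDeriv (thetaQuot a b)) := by
  funext i j
  have inner : ∀ z₁, iteratedDeriv ((j : ℕ) - 1) (fun z₂ => bidiff a b z₁ z₂) 0 =
      -iteratedDeriv j (logDeriv (thetaQuot a b)) (0 - z₁) := fun z₁ => by
    rw [funext (bidiff_eq a b z₁), iteratedDeriv_fun_neg, iteratedDeriv_comp_sub_const,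
      ← iteratedDeriv_succ', Nat.sub_add_cancel j.pos]
  rw [qcoef, funext inner, iteratedDeriv_fun_neg, iteratedDeriv_comp_const_sub,
    iteratedDeriv_iteratedDeriv, kernelCoeff_eq]
  simp only [sub_zero, smul_eq_mul, neg_div]

theorem qform_eq_timesForm (a b : ℝ) (t : Times) :
    qform a b t = timesForm (kernelCoeff (logDeriv (thetaQuot a b))) t t := by
  rw [← qcoef_eq_kernelCoeff, qform, timesForm]

/-- The closed form of `τ₀(t - ∑ᵣ [xᵣ])`, meaningful wherever `θ₁₁(xᵣ / 2ω₁) ≠ 0`, also when the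
series `q(t - ∑ᵣ [xᵣ])` diverges. -/
noncomputable def shiftedSeed (a b : ℝ) (e : ℂ) {N : ℕ} (t : Times) (x : Fin N → ℂ) : ℂ :=
  Complex.exp (qform a b t / 2) *
    Complex.exp (∑ r, (timeSeries (logDeriv (thetaQuot a b)) t (x r) -
      timeSeries (logDeriv (thetaQuot a b)) t 0)) *
    primeFactor (thetaQuot a b) x * theta a b ((t 1 - ∑ r, x r) / twoω₁ b + e)

section Seed

variable {a b : ℝ} (ha : 0 < a) (hb : 0 < b)

include ha hb

theorem isOpen_thetaQuot_ne_zero : IsOpen {u | thetaQuot a b u ≠ 0} :=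
  isOpen_ne_fun (differentiable_thetaQuot ha hb).continuous continuous_const

theorem exists_closedBall_subset_thetaQuot_ne_zero :
    ∃ ρ : ℝ, 0 < ρ ∧ Metric.closedBall 0 (4 * ρ) ⊆ {u | thetaQuot a b u ≠ 0} := by
  obtain ⟨ε, hε, hsub⟩ := Metric.nhds_basis_closedBall.mem_iff.1
    ((isOpen_thetaQuot_ne_zero ha hb).mem_nhds (thetaQuot_zero_ne_zero ha hb))
  exact ⟨ε / 4, by positivity, by rwa [mul_div_cancel₀ ε four_ne_zero]⟩

theorem exists_qSummable_of_mem_tameTimes :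
    ∃ ρ : ℝ, 0 < ρ ∧ Metric.closedBall 0 (4 * ρ) ⊆ {u | thetaQuot a b u ≠ 0} ∧
      ∀ t ∈ tameTimes ρ⁻¹, QSummable a b t := by
  obtain ⟨ρ, hρ, hball⟩ := exists_closedBall_subset_thetaQuot_ne_zero ha hb
  obtain ⟨C, hC⟩ := exists_norm_kernelCoeff_le
    (differentiableOn_logDeriv (differentiable_thetaQuot ha hb)) hρ hball
  refine ⟨ρ, hρ, hball, fun t ht => ?_⟩
  rw [QSummable, qcoef_eq_kernelCoeff]
  exact summable_timesForm (inv_nonneg.2 hρ.le) hC ht ht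

theorem IsEntireTimes.qSummable {t : Times} (ht : IsEntireTimes t) : QSummable a b t := by
  obtain ⟨ρ, -, -, h⟩ := exists_qSummable_of_mem_tameTimes ha hb
  exact h t (ht.mem_tameTimes _)

theorem differentiable_qform_dilate {t : Times} (ht : IsEntireTimes t) :
    Differentiable ℂ fun l => qform a b (dilate l t) := by
  obtain ⟨ρ, hρ, hball⟩ := exists_closedBall_subset_thetaQuot_ne_zero ha hb
  obtain ⟨C, hC⟩ := exists_norm_kernelCoeff_le
    (differentiableOn_logDeriv (differentiable_thetaQuot ha hb)) hρ hball
  simp only [qform_eq_timesForm]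
  exact differentiable_timesForm_dilate (inv_nonneg.2 hρ.le) hC ht

theorem tauSeries_sub_sum_miwa {ρ : ℝ} (hρ : 0 < ρ)
    (hball : Metric.closedBall 0 (4 * ρ) ⊆ {u | thetaQuot a b u ≠ 0}) (e : ℂ) {N : ℕ} {t : Times}
    (ht : IsEntireTimes t) {x : Fin N → ℂ} (hx : ∀ r, ‖x r‖ < ρ) :
    tauSeries a b e (t - ∑ r, miwa (x r)) = shiftedSeed a b e t x := by
  have first_time : (t - ∑ r, miwa (x r)) 1 = t 1 - ∑ r, x r := by simp [miwa]
  rw [tauSeries, shiftedSeed, first_time, qform_eq_timesForm, qform_eq_timesForm,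
    exp_timesForm_sub_sum_miwa (differentiable_thetaQuot ha hb) (thetaQuot_neg a b) hρ hball ht hx]

theorem eventually_tauSeries_dilate_eq_shiftedSeed (e : ℂ) {N : ℕ} {t : Times}
    (ht : IsEntireTimes t) (x : Fin N → ℂ) :
    ∀ᶠ l in 𝓝 0, QSummable a b (dilate l (t - ∑ r, miwa (x r))) ∧
      shiftedSeed a b e (dilate l t) (fun r => l * x r) =
        tauSeries a b e (dilate l (t - ∑ r, miwa (x r))) := by
  obtain ⟨ρ, hρ, hball, summable⟩ := exists_qSummable_of_mem_tameTimes ha hb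
  have small : ∀ᶠ l : ℂ in 𝓝 0, ∀ r, ‖l * x r‖ < ρ := by
    refine eventually_all.2 fun r => ?_
    have continuous : Continuous fun l : ℂ => ‖l * x r‖ := by fun_prop
    exact continuous.continuousAt.eventually_lt continuousAt_const (by simpa using hρ)
  filter_upwards [small] with l hl
  rw [dilate_sub_sum_miwa]
  exact ⟨summable _ (sub_mem ((ht.dilate l).mem_tameTimes _)
    (sum_mem fun r _ => miwa_mem_tameTimes (hl r))),
    (tauSeries_sub_sum_miwa ha hb hρ hball e (ht.dilate l) hl).symm⟩

theorem differentiableAt_shiftedSeed_dilate (e : ℂ) {N : ℕ} {t : Times} (ht : IsEntireTimes t)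
    {x : Fin N → ℂ} {l₀ : ℂ} (hx : ∀ r, thetaQuot a b (l₀ * x r) ≠ 0) :
    DifferentiableAt ℂ (fun l => shiftedSeed a b e (dilate l t) fun r => l * x r) l₀ := by
  have hE := differentiable_thetaQuot ha hb
  have series : ∀ u, thetaQuot a b (l₀ * u) ≠ 0 → DifferentiableAt ℂ
      (fun l => timeSeries (logDeriv (thetaQuot a b)) (dilate l t) (l * u)) l₀ := fun u hu =>
    differentiableAt_timeSeries_dilate (isOpen_thetaQuot_ne_zero ha hb)
      (differentiableOn_logDeriv hE) ht hu
  have series_zero : DifferentiableAt ℂ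
      (fun l => timeSeries (logDeriv (thetaQuot a b)) (dilate l t) 0) l₀ := by
    simpa only [mul_zero] using series 0 (by rw [mul_zero]; exact thetaQuot_zero_ne_zero ha hb)
  have theta_arg : DifferentiableAt ℂ
      (fun l => (dilate l t 1 - ∑ r, l * x r) / twoω₁ b + e) l₀ := by
    simp only [dilate]
    fun_prop
  exact ((((differentiable_qform_dilate ha hb ht l₀).div_const 2).cexp.mul
    (DifferentiableAt.fun_sum fun r _ => (series _ (hx r)).sub series_zero).cexp).mul
    (differentiableAt_primeFactor hE hx)).mul
    ((differentiable_theta ha hb _).comp l₀ theta_arg)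

theorem isTauValue_shiftedSeed (e : ℂ) {N : ℕ} {t : Times} (ht : IsEntireTimes t)
    {x : Fin N → ℂ} (hx : ∀ r, thetaQuot a b (x r) ≠ 0) :
    IsTauValue a b e (t - ∑ r, miwa (x r)) (shiftedSeed a b e t x) := by
  have hE : ∀ c : ℂ, Differentiable ℂ fun l => thetaQuot a b (l * c) := fun c =>
    (differentiable_thetaQuot ha hb).comp (differentiable_id.mul_const c)
  have hE_zero := thetaQuot_zero_ne_zero ha hb
  set S : Set ℂ := ⋃ r, {l | thetaQuot a b (l * x r) = 0} with hS
  have isClosed : IsClosed S := isClosed_iUnion_of_finite fun r =>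
    isClosed_eq (hE (x r)).continuous continuous_const
  have countable : S.Countable := Set.countable_iUnion fun r =>
    countable_zeros (hE (x r)) (z₀ := 0) (by rwa [zero_mul])
  refine ⟨2, S, fun l => shiftedSeed a b e (dilate l t) fun r => l * x r, one_lt_two, countable,
    by simp [hS, hE_zero], by simpa [hS] using hx, Metric.isOpen_ball.sdiff isClosed, ?_,
    eventually_tauSeries_dilate_eq_shiftedSeed ha hb e ht x, by simp only [dilate_one, one_mul]⟩
  rintro l ⟨-, hl⟩
  have hl' : ∀ r, thetaQuot a b (l * x r) ≠ 0 := by simpa [hS] using hl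
  exact (differentiableAt_shiftedSeed_dilate ha hb e ht hl').differentiableWithinAt

end Seed

/-! ### The dressed tau function -/

section Fcoef

variable {a b : ℝ} (ha : 0 < a) (hb : 0 < b)

include ha hb

theorem dlogTheta_eventuallyEq {p : ℂ} (hp : theta11 a b (p / twoω₁ b) ≠ 0) :
    dlogTheta a b =ᶠ[𝓝 p] logDeriv (thetaQuot a b) + Inv.inv := by
  filter_upwards [(isOpen_thetaQuot_ne_zero ha hb).mem_nhds (thetaQuot_ne_zero hp),
    isOpen_ne.mem_nhds (ne_zero_of_theta11_ne_zero hp)] with z hz hz_zero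
  have prime_form : (fun w => theta11 a b (w / twoω₁ b)) = fun w => w * thetaQuot a b w :=
    funext fun w => (mul_thetaQuot a b w).symm
  rw [dlogTheta, prime_form, logDeriv_mul z hz_zero hz differentiableAt_fun_id
    (differentiable_thetaQuot ha hb z), logDeriv_id', Pi.add_apply, add_comm, one_div]

theorem Fcoef_eq {p : ℂ} (hp : theta11 a b (p / twoω₁ b) ≠ 0) (k : ℕ+) :
    Fcoef a b k p = altTaylorCoeff (logDeriv (thetaQuot a b)) k p + p⁻¹ ^ (k : ℕ) := by
  have analytic := (differentiableOn_logDeriv (differentiable_thetaQuot ha hb)).analyticAt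
    ((isOpen_thetaQuot_ne_zero ha hb).mem_nhds (thetaQuot_ne_zero hp))
  change altTaylorCoeff (dlogTheta a b) k p = _
  rw [altTaylorCoeff_congr (dlogTheta_eventuallyEq ha hb hp),
    altTaylorCoeff_add analytic (analyticAt_inv (ne_zero_of_theta11_ne_zero hp)),
    altTaylorCoeff_inv]

theorem summable_mul_altTaylorCoeff_logDeriv_thetaQuot {t : Times} (ht : IsEntireTimes t) {w : ℂ}
    (hw : thetaQuot a b w ≠ 0) :
    Summable fun k : ℕ+ => t k * altTaylorCoeff (logDeriv (thetaQuot a b)) k w :=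
  summable_mul_altTaylorCoeff (isOpen_thetaQuot_ne_zero ha hb)
    (differentiableOn_logDeriv (differentiable_thetaQuot ha hb)) ht hw

theorem hasSum_mul_Fcoef {t : Times} (ht : IsEntireTimes t) {p : ℂ}
    (hp : theta11 a b (p / twoω₁ b) ≠ 0) :
    HasSum (fun k : ℕ+ => t k * Fcoef a b k p)
      (timeSeries (logDeriv (thetaQuot a b)) t p + eta t p⁻¹) := by
  have add := (summable_mul_altTaylorCoeff_logDeriv_thetaQuot ha hb ht
    (thetaQuot_ne_zero hp)).hasSum.add (ht.summable_eta p⁻¹).hasSum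
  exact add.congr_fun fun k => by rw [Fcoef_eq ha hb hp, mul_add]

theorem hasSum_neg_natCast_mul_altTaylorCoeff (N : ℕ) {t : Times} (ht : IsEntireTimes t) :
    HasSum (fun k : ℕ+ => -N * altTaylorCoeff (logDeriv (thetaQuot a b)) k 0 * t k)
      (-N * timeSeries (logDeriv (thetaQuot a b)) t 0) :=
  ((summable_mul_altTaylorCoeff_logDeriv_thetaQuot ha hb ht
    (thetaQuot_zero_ne_zero ha hb)).hasSum.mul_left (-N : ℂ)).congr_fun fun k => by ring

end Fcoef

/-- The constant `c`: the product of the factors of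
`Δ(x₁⁻¹, …, x_N⁻¹) primeFactor (thetaQuot a b) x` that do not depend on `x`. -/
noncomputable def tauConst (a b : ℝ) (N : ℕ) : ℂ :=
  (∏ _r : Fin N, thetaQuot a b 0) * ∏ r : Fin N, ∏ _s ∈ Ioi r, -thetaQuot a b 0

theorem tauConst_ne_zero {a b : ℝ} (ha : 0 < a) (hb : 0 < b) (N : ℕ) : tauConst a b N ≠ 0 := by
  have h := thetaQuot_zero_ne_zero ha hb
  exact mul_ne_zero (prod_ne_zero_iff.2 fun _ _ => h)
    (prod_ne_zero_iff.2 fun _ _ => prod_ne_zero_iff.2 fun _ _ => neg_ne_zero.2 h)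

theorem prod_prod_Ioi_mul_eq_prod_pow {R : Type*} [CommMonoid R] {N : ℕ} (f : Fin N → R) :
    ∏ r, ∏ s ∈ Ioi r, f r * f s = ∏ r, f r ^ (N - 1) := by
  rw [prod_prod_Ioi_mul_eq_prod_prod_off_diag fun _ r => f r]
  refine prod_congr rfl fun r _ => ?_
  rw [prod_const, card_compl, card_singleton, Fintype.card_fin]

theorem vdm_inv_mul_primeFactor {a b : ℝ} {N : ℕ} {x : Fin N → ℂ}
    (hx : ∀ r, theta11 a b (x r / twoω₁ b) ≠ 0) :
    vdm (fun r => (x r)⁻¹) * primeFactor (thetaQuot a b) x = tauConst a b N *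
      ((∏ r, x r / theta11 a b (x r / twoω₁ b) ^ N) *
        ∏ r, ∏ s ∈ Ioi r, theta11 a b ((x s - x r) / twoω₁ b)) := by
  have hx_zero : ∀ r, x r ≠ 0 := fun r => ne_zero_of_theta11_ne_zero (hx r)
  have node_factor : ∀ r, thetaQuot a b 0 / thetaQuot a b (x r) =
      thetaQuot a b 0 * (x r / theta11 a b (x r / twoω₁ b)) := fun r => by
    rw [← mul_thetaQuot, div_mul_cancel_left₀ (hx_zero r), div_eq_mul_inv]
  have pair_factor : ∀ r s, ((x s)⁻¹ - (x r)⁻¹) *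
      (thetaQuot a b (x s - x r) * thetaQuot a b 0 / (thetaQuot a b (x r) * thetaQuot a b (x s))) =
      -thetaQuot a b 0 * ((theta11 a b (x r / twoω₁ b))⁻¹ * (theta11 a b (x s / twoω₁ b))⁻¹) *
        theta11 a b ((x s - x r) / twoω₁ b) := fun r s => by
    rw [← mul_thetaQuot, ← mul_thetaQuot, ← mul_thetaQuot,
      inv_sub_inv (hx_zero s) (hx_zero r), mul_inv, mul_inv]
    ring
  have node_power : ∀ r, x r / theta11 a b (x r / twoω₁ b) ^ N =
      x r / theta11 a b (x r / twoω₁ b) * (theta11 a b (x r / twoω₁ b))⁻¹ ^ (N - 1) := fun r => by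
    rw [← mul_pow_sub_one (Fin.pos r).ne', inv_pow, div_mul_eq_div_div, div_eq_mul_inv]
  rw [vdm, primeFactor, mul_left_comm]
  simp only [← prod_mul_distrib, pair_factor]
  simp only [prod_mul_distrib, node_factor, node_power, tauConst,
    ← prod_prod_Ioi_mul_eq_prod_pow]
  ring

theorem dressedTerm_tau0_eq {a b : ℝ} (ha : 0 < a) (hb : 0 < b) (e : ℂ) {N M : ℕ}
    (p : Fin (N + M) → ℂ) (hp : ∀ i, theta11 a b (p i / twoω₁ b) ≠ 0) {t : Times}
    (ht : IsEntireTimes t) (I : Fin N → Fin (N + M)) :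
    dressedTerm (tau0 a b e) t (p ∘ I) = tauConst a b N *
      Complex.exp (-N * timeSeries (logDeriv (thetaQuot a b)) t 0 + qform a b t / 2) *
        (Ccoef a b p I * Complex.exp (∑ r, ∑' k : ℕ+, t k * Fcoef a b k (p (I r))) *
          theta a b ((t 1 - ∑ r, p (I r)) / twoω₁ b + e)) := by
  have seed := (isTauValue_shiftedSeed ha hb e ht (x := fun r => p (I r))
    fun r => thetaQuot_ne_zero (hp (I r))).tau0_eq
  have constant := vdm_inv_mul_primeFactor (x := fun r => p (I r)) fun r => hp (I r)
  have exponent : ∑ r, eta t (p (I r))⁻¹ +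
      ∑ r, (timeSeries (logDeriv (thetaQuot a b)) t (p (I r)) -
        timeSeries (logDeriv (thetaQuot a b)) t 0) =
      -N * timeSeries (logDeriv (thetaQuot a b)) t 0 +
        ∑ r, ∑' k : ℕ+, t k * Fcoef a b k (p (I r)) := by
    rw [sum_congr rfl fun r _ => (hasSum_mul_Fcoef ha hb ht (hp (I r))).tsum_eq, sum_add_distrib,
      sum_sub_distrib, sum_const, card_univ, Fintype.card_fin, nsmul_eq_mul]
    ring
  have exponential := congrArg Complex.exp exponent
  rw [Complex.exp_add, Complex.exp_add] at exponential
  simp only [dressedTerm, Function.comp_apply, seed, shiftedSeed, Ccoef, Complex.exp_add]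
  set θ := theta a b ((t 1 - ∑ r, p (I r)) / twoω₁ b + e)
  linear_combination
    vdm (fun r => (p (I r))⁻¹) * Complex.exp (qform a b t / 2) *
      primeFactor (thetaQuot a b) (fun r => p (I r)) * θ * exponential +
    Complex.exp (qform a b t / 2) * θ *
      Complex.exp (∑ r, ∑' k : ℕ+, t k * Fcoef a b k (p (I r))) *
      Complex.exp (-N * timeSeries (logDeriv (thetaQuot a b)) t 0) * constant

end EllipticKP

theorem mainTheorem8 (a b : ℝ) (ha : 0 < a) (hb : 0 < b) (N : ℕ) :
    ∃ (c : ℂ) (cc : ℕ+ → ℂ), c ≠ 0 ∧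
      ∀ (M : ℕ) (p : Fin (N + M) → ℂ) (A : Matrix (Fin M) (Fin N) ℂ) (e : ℂ)
        (t : EllipticKP.Times),
        (∀ i, EllipticKP.theta11 a b (p i / EllipticKP.twoω₁ b) ≠ 0) →
        (∀ (i : Fin M) (j : Fin N), EllipticKP.qPart p i ≠ EllipticKP.pPart p j) →
        EllipticKP.IsEntireTimes t →
        -- all the quantities that occur are well defined
        EllipticKP.QSummable a b t ∧
        EllipticKP.IsTauValue a b e t (EllipticKP.tauSeries a b e t) ∧
        (∀ I ∈ EllipticKP.indexSets N M,
          ∃ v, EllipticKP.IsTauValue a b e (t - ∑ r, EllipticKP.miwa (p (I r))) v) ∧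
        Summable (fun j : ℕ+ => cc j * t j) ∧
        (∀ i, Summable fun k : ℕ+ => t k * EllipticKP.Fcoef a b k (p i)) ∧
        -- the formula
        EllipticKP.tauVO a b e p A t =
          c * Complex.exp ((∑' j : ℕ+, cc j * t j) + EllipticKP.qform a b t / 2) *
            ∑ I ∈ EllipticKP.indexSets N M,
              EllipticKP.minorB p A I * EllipticKP.Ccoef a b p I *
                Complex.exp (∑ r, ∑' k : ℕ+, t k * EllipticKP.Fcoef a b k (p (I r))) *
                EllipticKP.theta a b
                  ((t 1 - ∑ r, p (I r)) / EllipticKP.twoω₁ b + e) := by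
  refine ⟨EllipticKP.tauConst a b N, fun k => -N *
      EllipticKP.altTaylorCoeff (logDeriv (EllipticKP.thetaQuot a b)) k 0,
    EllipticKP.tauConst_ne_zero ha hb N, fun M p A e t hp hpq ht => ?_⟩
  have hasSum_linear := EllipticKP.hasSum_neg_natCast_mul_altTaylorCoeff ha hb N ht
  refine ⟨ht.qSummable ha hb, ?_, fun I _ => ?_, hasSum_linear.summable,
    fun i => (EllipticKP.hasSum_mul_Fcoef ha hb ht (hp i)).summable, ?_⟩
  · exact EllipticKP.isTauValue_tauSeries ha hb e one_lt_two ((ht.dilate _).qSummable ha hb)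
  · exact ⟨_, EllipticKP.isTauValue_shiftedSeed ha hb e ht
      fun r => EllipticKP.thetaQuot_ne_zero (hp (I r))⟩
  · refine (EllipticKP.vdm_mul_expVertex_eq_sum_minorB p A (EllipticKP.tau0 a b e) t hpq).trans ?_
    rw [mul_sum, hasSum_linear.tsum_eq]
    refine sum_congr rfl fun I _ => ?_
    rw [EllipticKP.dressedTerm_tau0_eq ha hb e p hp ht I]
    ring
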